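/- Let $\tau$ be a complex number with $\operatorname{Im}\tau>0$, put $q=e^{2\pi i\tau}$ (so $0<|q|<1$), and for rational $r$ write $q^r=e^{2\pi i r\tau}$. For $|p|<1$ let $(a;p)_n=\prod_{k=0}^{n-1}(1-ap^k)$, $(a;p)_\infty=\prod_{k\ge 0}(1-ap^k)$ and $(a_1,\dots,a_m;p)_\infty=(a_1;p)_\infty\cdots(a_m;p)_\infty$. Put $J_m=(q^m;q^m)_\infty$, $J_{a,m}=(q^a,q^{m-a},q^m;q^m)_\infty$, and $$F(u,v,w,t;q^2)=\sum_{i,j,k,l\ge 0}\frac{u^iv^jw^kt^l\,q^{i^2+j^2+k^2+l^2-il-jl-kl}}{(q^2;q^2)_i(q^2;q^2)_j(q^2;q^2)_k(q^2;q^2)_l}.$$ Then this series converges absolutely for all complex $u,v,w,t$, and the following hold. 1. For every $b\in\mathbb{Q}$, $$F(q^{b},q^{-b},1,1;q^2)=\frac{J_{2}^{3}(-q^{1-b},-q^{1+b};q^2)_{\infty}(-q^{2+b},-q^{2-b};q^4)_{\infty}}{J_{1}^{2}J_{4}}+2q\frac{J_{4}^{3}(-q^{-b},-q^{2+b};q^2)_{\infty}(-q^{b},-q^{4-b};q^4)_{\infty}}{J_{2}^{3}}.$$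 2. $$F(q^{-1},q,q,1;q^2)=2\frac{J_{4}^{9}}{J_{2}^{7}J_{8}^{2}}+\frac{J_{2}^{7}J_{8}^{2}}{J_{1}^{4}J_{4}^{5}}.$$ 3. $$F(q,q^{-1},1,q^{1/2};q^2)=2\frac{J_{4}J_{5,12}}{J_{1}^{2}}+2q^{1/2}\frac{J_{2}^{3}J_{2,12}}{J_{1}^{3}J_{4}}-2q\frac{J_{4}J_{1,12}}{J_{1}^{2}}.$$ 4. $$F(1,1,q^{-1},q^{1/2};q^2)=2\frac{J_2^3J_6^2}{J_1^3J_4J_{12}}+4q^{1/2}\frac{J_3J_4J_{12}}{J_1^2J_6}.$$ 5. $$F(1,1,q^{-1},1;q^2)=8\frac{J_{2}^{3}}{J_{1}^{3}}.$$ -/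

import Mathlib

open scoped UpperHalfPlane

noncomputable section

/-- `qPow τ r` is `q ^ r = exp (2 π i r τ)` where `q = exp (2 π i τ)`: the rational powers of `q`
are taken with respect to one fixed logarithm `2 π i τ` of `q`. -/
def qPow (τ : ℍ) (r : ℚ) : ℂ :=
  Complex.exp (2 * (Real.pi : ℂ) * Complex.I * (r : ℂ) * (τ : ℂ))

/-- The finite product `(a; q)_n = ∏_{k = 0}^{n - 1} (1 - a q ^ k)`. -/
def qPoch (a q : ℂ) (n : ℕ) : ℂ := ∏ k ∈ Finset.range n, (1 - a * q ^ k)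

/-- The infinite product `(a; q)_∞ = ∏_{k ≥ 0} (1 - a q ^ k)`. -/
def qPochInf (a q : ℂ) : ℂ := ∏' k : ℕ, (1 - a * q ^ k)

/-- The product `(a; q)_∞` converges whenever `|q| < 1`. -/
theorem multipliable_qPochInf (a q : ℂ) (hq : ‖q‖ < 1) :
    Multipliable fun k : ℕ => 1 - a * q ^ k := by
  have h : Summable fun k : ℕ => ‖-(a * q ^ k)‖ := by
    simpa [norm_mul] using (summable_geometric_of_lt_one (norm_nonneg q) hq).mul_left ‖a‖
  simpa [sub_eq_add_neg] using multipliable_one_add_of_summable h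

/-- `J_m = (q ^ m; q ^ m)_∞`. -/
def qJ (q : ℂ) (m : ℕ) : ℂ := qPochInf (q ^ m) (q ^ m)

/-- `J_{a, m} = (q ^ a, q ^ (m - a), q ^ m; q ^ m)_∞`. -/
def qJ₂ (q : ℂ) (a m : ℕ) : ℂ :=
  qPochInf (q ^ a) (q ^ m) * qPochInf (q ^ ((m : ℤ) - (a : ℤ))) (q ^ m) * qPochInf (q ^ m) (q ^ m)

/-- The general term, with index `n = (i, j, k, l)`, of the series `F(u, v, w, t; q ^ 2)`. -/
def nahmTerm (u v w t q : ℂ) (n : ℕ × ℕ × ℕ × ℕ) : ℂ :=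
  match n with
  | (i, j, k, l) =>
    u ^ i * v ^ j * w ^ k * t ^ l *
        q ^ ((i : ℤ) ^ 2 + (j : ℤ) ^ 2 + (k : ℤ) ^ 2 + (l : ℤ) ^ 2
              - (i : ℤ) * l - (j : ℤ) * l - (k : ℤ) * l) /
      (qPoch (q ^ 2) (q ^ 2) i * qPoch (q ^ 2) (q ^ 2) j *
        qPoch (q ^ 2) (q ^ 2) k * qPoch (q ^ 2) (q ^ 2) l)

/-- The series `F(u, v, w, t; q ^ 2)`, as a function of `u, v, w, t` and `q`. -/
def nahmF (u v w t q : ℂ) : ℂ := ∑' n : ℕ × ℕ × ℕ × ℕ, nahmTerm u v w t q n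

end

/-!
Euler's formula sums the series over `i`, `j` and `k`, which leaves a single series over `l`. Its
terms of index `l = 2 n + δ` with `δ ∈ {0, 1}` are, when `u v t² = 1` and up to a factor independent
of `n`, the weight of a limiting case of Bailey's lemma times
`(-q ^ (1 + δ) / u, -q ^ (1 + δ) / v; q²)_n / (q²; q²)_{2 n + δ}`. For `v = u⁻¹, t = 1` the latter
is evaluated by the finite Jacobi triple product, and for `u = q⁻¹, v = 1, t² = q` it collapses to
`1 / (q; q)_{2 n + δ}`; either way it is a finite bilateral sum, that is, the second member of a
Bailey pair relative to `q ^ (2 δ)` whose first member is essentially Gaussian. The conjugate Bailey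
sequence is evaluated by the `₁φ₁` summation, which turns each half of the series into a theta
series, and the Jacobi triple product turns theta series into quotients of `J_m`.
-/

noncomputable section

open Filter Topology
open Finset.HasAntidiagonal (antidiagonal mem_antidiagonal)

/-! ### `q`-shifted factorials -/

theorem qPoch_zero (a p : ℂ) : qPoch a p 0 = 1 := by simp [qPoch]

theorem qPoch_succ (a p : ℂ) (n : ℕ) : qPoch a p (n + 1) = qPoch a p n * (1 - a * p ^ n) := by
  simp [qPoch, Finset.prod_range_succ]

theorem qPoch_add (a p : ℂ) (m n : ℕ) :
    qPoch a p (m + n) = qPoch a p m * qPoch (a * p ^ m) p n := by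
  simp only [qPoch, Finset.prod_range_add]
  congr 1
  exact Finset.prod_congr rfl fun k _ => by ring

theorem qPoch_succ' (a p : ℂ) (n : ℕ) : qPoch a p (n + 1) = (1 - a) * qPoch (a * p) p n := by
  rw [add_comm, qPoch_add]
  simp [qPoch]

theorem qPoch_mul_neg (a p : ℂ) (n : ℕ) :
    qPoch a p n * qPoch (-a) p n = qPoch (a ^ 2) (p ^ 2) n := by
  simp only [qPoch, ← Finset.prod_mul_distrib]
  exact Finset.prod_congr rfl fun k _ => by ring

theorem qPoch_mul_length (a p : ℂ) (m n : ℕ) :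
    qPoch a p (m * n) = ∏ j ∈ Finset.range m, qPoch (a * p ^ j) (p ^ m) n := by
  induction n with
  | zero => simp [qPoch]
  | succ n ih =>
    rw [mul_add, mul_one, qPoch_add, ih]
    simp only [qPoch_succ, Finset.prod_mul_distrib]
    congr 1
    exact Finset.prod_congr rfl fun k _ => by ring

theorem qPoch_div_pow_mul {q : ℂ} (hq : q ≠ 0) {x : ℂ} (hx : x ≠ 0) (n : ℕ) :
    qPoch (x / (q ^ 2) ^ n) (q ^ 2) n * q ^ (n ^ 2 + n) =
      (-x) ^ n * qPoch (q ^ 2 / x) (q ^ 2) n := by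
  induction n with
  | zero => simp [qPoch_zero]
  | succ n ih =>
    have shift : x / (q ^ 2) ^ (n + 1) * q ^ 2 = x / (q ^ 2) ^ n := by
      field_simp
      ring
    rw [qPoch_succ', shift, qPoch_succ (q ^ 2 / x), pow_succ (-x)]
    calc _ = (1 - x / (q ^ 2) ^ (n + 1)) * q ^ (2 * n + 2) *
          (qPoch (x / (q ^ 2) ^ n) (q ^ 2) n * q ^ (n ^ 2 + n)) := by ring
      _ = _ := by
        rw [ih]
        field_simp
        ring

section

variable {p : ℂ}

theorem one_sub_ne_zero_of_norm_lt_one {x : ℂ} (hx : ‖x‖ < 1) : 1 - x ≠ 0 :=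
  sub_ne_zero.mpr fun h => hx.ne (by simp [← h])

theorem one_add_ne_zero_of_norm_lt_one {x : ℂ} (hx : ‖x‖ < 1) : 1 + x ≠ 0 := by
  simpa using one_sub_ne_zero_of_norm_lt_one (x := -x) (by simpa using hx)

theorem norm_pow_lt_one (hp : ‖p‖ < 1) {m : ℕ} (hm : m ≠ 0) : ‖p ^ m‖ < 1 := by
  rw [norm_pow]
  exact pow_lt_one₀ (norm_nonneg p) hp hm

theorem norm_mul_pow_lt_one (hp : ‖p‖ < 1) {a : ℂ} (ha : ‖a‖ < 1) (k : ℕ) : ‖a * p ^ k‖ < 1 := by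
  rw [norm_mul, norm_pow]
  exact (mul_le_of_le_one_right (norm_nonneg a) (pow_le_one₀ (norm_nonneg p) hp.le)).trans_lt ha

theorem qPoch_ne_zero (hp : ‖p‖ < 1) {a : ℂ} (ha : ‖a‖ < 1) (n : ℕ) : qPoch a p n ≠ 0 :=
  Finset.prod_ne_zero_iff.mpr fun k _ =>
    one_sub_ne_zero_of_norm_lt_one (norm_mul_pow_lt_one hp ha k)

theorem norm_qPoch_le (hp : ‖p‖ < 1) (a : ℂ) (n : ℕ) :
    ‖qPoch a p n‖ ≤ Real.exp (‖a‖ / (1 - ‖p‖)) := by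
  have geom := summable_geometric_of_lt_one (norm_nonneg p) hp
  calc ‖qPoch a p n‖ = ∏ k ∈ Finset.range n, ‖1 - a * p ^ k‖ := norm_prod _ _
    _ ≤ ∏ k ∈ Finset.range n, Real.exp (‖a‖ * ‖p‖ ^ k) :=
      Finset.prod_le_prod (fun _ _ => norm_nonneg _) fun k _ => by
        have tri := norm_sub_le 1 (a * p ^ k)
        rw [norm_one, norm_mul, norm_pow] at tri
        linarith [Real.add_one_le_exp (‖a‖ * ‖p‖ ^ k)]
    _ = Real.exp (‖a‖ * ∑ k ∈ Finset.range n, ‖p‖ ^ k) := by rw [← Real.exp_sum, Finset.mul_sum]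
    _ ≤ _ := by
      rw [div_eq_mul_inv, ← tsum_geometric_of_lt_one (norm_nonneg p) hp]
      gcongr
      exact geom.sum_le_tsum _ fun _ _ => by positivity

theorem tendsto_qPoch (hp : ‖p‖ < 1) (a : ℂ) :
    Tendsto (qPoch a p) atTop (𝓝 (qPochInf a p)) :=
  (multipliable_qPochInf a p hp).tendsto_prod_tprod_nat

theorem qPochInf_eq_qPoch_mul (hp : ‖p‖ < 1) (a : ℂ) (n : ℕ) :
    qPochInf a p = qPoch a p n * qPochInf (a * p ^ n) p := by
  refine tendsto_nhds_unique ((tendsto_qPoch hp a).comp (tendsto_add_atTop_nat n)) ?_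
  refine ((tendsto_qPoch hp (a * p ^ n)).const_mul (qPoch a p n)).congr fun m => ?_
  rw [← qPoch_add, add_comm]
  rfl

theorem qPochInf_eq_mul (hp : ‖p‖ < 1) (a : ℂ) : qPochInf a p = (1 - a) * qPochInf (a * p) p := by
  simpa [qPoch] using qPochInf_eq_qPoch_mul hp a 1

theorem qPochInf_ne_zero (hp : ‖p‖ < 1) {a : ℂ} (ha : ∀ k : ℕ, 1 - a * p ^ k ≠ 0) :
    qPochInf a p ≠ 0 := by
  have hs : Summable fun k : ℕ => ‖-(a * p ^ k)‖ := by
    simpa [norm_mul] using (summable_geometric_of_lt_one (norm_nonneg p) hp).mul_left ‖a‖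
  simpa [qPochInf, ← sub_eq_add_neg] using
    tprod_one_add_ne_zero_of_summable (by simpa [← sub_eq_add_neg] using ha) hs

theorem qPochInf_ne_zero_of_norm_lt_one (hp : ‖p‖ < 1) {a : ℂ} (ha : ‖a‖ < 1) :
    qPochInf a p ≠ 0 :=
  qPochInf_ne_zero hp fun k => one_sub_ne_zero_of_norm_lt_one (norm_mul_pow_lt_one hp ha k)

theorem qPochInf_mul_neg (hp : ‖p‖ < 1) (a : ℂ) :
    qPochInf a p * qPochInf (-a) p = qPochInf (a ^ 2) (p ^ 2) := by
  refine tendsto_nhds_unique ((tendsto_qPoch hp a).mul (tendsto_qPoch hp (-a))) ?_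
  simpa only [qPoch_mul_neg] using tendsto_qPoch (norm_pow_lt_one hp two_ne_zero) (a ^ 2)

theorem qPochInf_eq_prod (hp : ‖p‖ < 1) (a : ℂ) {m : ℕ} (hm : m ≠ 0) :
    qPochInf a p = ∏ j ∈ Finset.range m, qPochInf (a * p ^ j) (p ^ m) := by
  have hmul : Tendsto (fun n : ℕ => m * n) atTop atTop :=
    tendsto_id.const_mul_atTop' (Nat.pos_of_ne_zero hm)
  refine tendsto_nhds_unique ((tendsto_qPoch hp a).comp hmul) ?_
  exact (tendsto_finsetProd (Finset.range m) fun j _ =>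
    tendsto_qPoch (norm_pow_lt_one hp hm) (a * p ^ j)).congr fun n =>
      (qPoch_mul_length a p m n).symm

theorem qPochInf_eq_mul_sq (hp : ‖p‖ < 1) (a : ℂ) :
    qPochInf a p = qPochInf a (p ^ 2) * qPochInf (a * p) (p ^ 2) := by
  simp [qPochInf_eq_prod hp a two_ne_zero, Finset.prod_range_succ]

theorem qPochInf_eq_mul_cube (hp : ‖p‖ < 1) (a : ℂ) :
    qPochInf a p =
      qPochInf a (p ^ 3) * qPochInf (a * p) (p ^ 3) * qPochInf (a * p ^ 2) (p ^ 3) := by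
  simp [qPochInf_eq_prod hp a three_ne_zero, Finset.prod_range_succ]

/-! ### Reciprocals of `(p; p)_k` -/

/-- The reciprocal `1 / (p; p)_k` for an integer `k`, with the convention that it vanishes for
`k < 0`. Thanks to this convention finite sums can be written over all of `ℤ`. -/
def qFactInv (p : ℂ) (k : ℤ) : ℂ := if 0 ≤ k then (qPoch p p k.toNat)⁻¹ else 0

theorem qFactInv_natCast (p : ℂ) (n : ℕ) : qFactInv p n = (qPoch p p n)⁻¹ := by
  simp [qFactInv]

theorem qFactInv_zero (p : ℂ) : qFactInv p 0 = 1 := by simp [qFactInv, qPoch_zero]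

theorem qFactInv_of_neg (p : ℂ) {k : ℤ} (hk : k < 0) : qFactInv p k = 0 := by
  simp [qFactInv, hk.not_ge]

theorem qFactInv_sub_one (hp : ‖p‖ < 1) (k : ℤ) :
    qFactInv p (k - 1) = (1 - p ^ k) * qFactInv p k := by
  rcases lt_trichotomy k 0 with h | rfl | h
  · rw [qFactInv_of_neg p h, qFactInv_of_neg p (by omega), mul_zero]
  · simp [qFactInv]
  · obtain ⟨n, rfl⟩ : ∃ n : ℕ, k = (n + 1 : ℕ) := ⟨(k - 1).toNat, by omega⟩
    have hn := one_sub_ne_zero_of_norm_lt_one (norm_mul_pow_lt_one hp hp n)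
    rw [show ((n + 1 : ℕ) : ℤ) - 1 = n by push_cast; ring, qFactInv_natCast, qFactInv_natCast,
      qPoch_succ, zpow_natCast, pow_succ']
    field_simp

theorem tendsto_qFactInv (hp : ‖p‖ < 1) : Tendsto (qFactInv p) atTop (𝓝 (qPochInf p p)⁻¹) := by
  rw [← Nat.map_cast_int_atTop, tendsto_map'_iff]
  simpa only [Function.comp_def, qFactInv_natCast] using
    (tendsto_qPoch hp p).inv₀ (qPochInf_ne_zero_of_norm_lt_one hp hp)

theorem exists_norm_qFactInv_le (hp : ‖p‖ < 1) : ∃ C : ℝ, 0 ≤ C ∧ ∀ k : ℤ, ‖qFactInv p k‖ ≤ C := by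
  obtain ⟨C, hC⟩ := (Metric.isBounded_range_of_tendsto _
    ((tendsto_qFactInv hp).comp tendsto_natCast_atTop_atTop)).exists_norm_le
  have hC0 : 0 ≤ C := (norm_nonneg _).trans (hC _ (Set.mem_range_self 0))
  refine ⟨C, hC0, fun k => ?_⟩
  rcases lt_or_ge k 0 with hk | hk
  · simpa [qFactInv_of_neg p hk] using hC0
  · lift k to ℕ using hk
    exact hC _ (Set.mem_range_self k)

theorem qFactInv_natCast_eq_div (hp : ‖p‖ < 1) (n : ℕ) :
    qFactInv p n = qPochInf (p * p ^ n) p / qPochInf p p := by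
  have tail := qPochInf_ne_zero_of_norm_lt_one hp (norm_mul_pow_lt_one hp hp n)
  have head := qPoch_ne_zero hp hp n
  rw [qFactInv_natCast, qPochInf_eq_qPoch_mul hp p n]
  field_simp

end

/-! ### Summability -/

theorem summable_pow_mul_pow_sq (x : ℝ) {s : ℝ} (h0 : 0 ≤ s) (h1 : s < 1) :
    Summable fun n : ℕ => |x| ^ n * s ^ (n ^ 2) := by
  have h : Tendsto (fun n : ℕ => |x| * s ^ n) atTop (𝓝 0) := by
    simpa using (tendsto_pow_atTop_nhds_zero_of_lt_one h0 h1).const_mul |x|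
  refine Summable.of_norm_bounded_eventually_nat
    (summable_geometric_of_lt_one (by norm_num : (0 : ℝ) ≤ 1 / 2) (by norm_num)) ?_
  filter_upwards [h.eventually_lt_const (by norm_num : (0 : ℝ) < 1 / 2)] with n hn
  rw [Real.norm_of_nonneg (by positivity), pow_two n, pow_mul, ← mul_pow]
  exact pow_le_pow_left₀ (by positivity) hn.le n

theorem summable_norm_pow_mul_pow_sq {q : ℂ} (hq : ‖q‖ < 1) (x : ℂ) :
    Summable fun n : ℕ => ‖x ^ n * q ^ (n ^ 2)‖ := by
  simpa [norm_mul, norm_pow] using summable_pow_mul_pow_sq ‖x‖ (norm_nonneg q) hq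

theorem summable_norm_zpow_mul_zpow_sq {q : ℂ} (hq : ‖q‖ < 1) (z : ℂ) :
    Summable fun r : ℤ => ‖z ^ r * q ^ (r ^ 2)‖ := by
  refine summable_int_iff_summable_nat_and_neg.mpr ⟨?_, ?_⟩
  · refine (summable_norm_pow_mul_pow_sq hq z).congr fun n => ?_
    norm_cast
  · refine (summable_norm_pow_mul_pow_sq hq z⁻¹).congr fun n => ?_
    rw [neg_sq, ← Nat.cast_pow, zpow_natCast, zpow_neg, zpow_natCast, inv_pow]

/-! ### Bilateral sums against `1 / ((p; p)_{a - r} (p; p)_{b + r})` -/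

/-- The sum `∑ c_r / ((p; p)_{a - r} (p; p)_{b + r})` over all integers `r`; only the finitely many
terms with `-b ≤ r ≤ a` are nonzero. -/
def bilatSum (p : ℂ) (a b : ℤ) (c : ℤ → ℂ) : ℂ :=
  ∑' r : ℤ, c r * (qFactInv p (a - r) * qFactInv p (b + r))

section

variable {p : ℂ} (a b : ℤ) (c d : ℤ → ℂ)

theorem summable_bilatSum (p : ℂ) :
    Summable fun r : ℤ => c r * (qFactInv p (a - r) * qFactInv p (b + r)) := by
  refine summable_of_hasFiniteSupport ((Set.finite_Icc (-b) a).subset fun r hr => ?_)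
  by_contra h
  rw [Set.mem_Icc, not_and_or, not_le, not_le] at h
  refine hr ?_
  rcases h with h | h
  · simp only [qFactInv_of_neg p (by omega : b + r < 0), mul_zero]
  · simp only [qFactInv_of_neg p (by omega : a - r < 0), zero_mul, mul_zero]

theorem bilatSum_add (p : ℂ) :
    bilatSum p a b (fun r => c r + d r) = bilatSum p a b c + bilatSum p a b d := by
  simp only [bilatSum, add_mul]
  exact (summable_bilatSum a b c p).tsum_add (summable_bilatSum a b d p)

theorem bilatSum_const_mul (p x : ℂ) :
    bilatSum p a b (fun r => x * c r) = x * bilatSum p a b c := by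
  simp only [bilatSum, mul_assoc, tsum_mul_left]

theorem bilatSum_zero_zero (p : ℂ) : bilatSum p 0 0 c = c 0 := by
  rw [bilatSum, tsum_eq_single 0]
  · simp [qFactInv_zero]
  · intro r hr
    rcases lt_or_gt_of_ne hr with h | h
    · rw [qFactInv_of_neg p (by omega : 0 + r < 0), mul_zero, mul_zero]
    · rw [qFactInv_of_neg p (by omega : 0 - r < 0), zero_mul, mul_zero]

theorem bilatSum_swap (p : ℂ) : bilatSum p a b c = bilatSum p b a fun r => c (-r) := by
  rw [bilatSum, bilatSum, ← (Equiv.neg ℤ).tsum_eq]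
  refine tsum_congr fun r => ?_
  rw [Equiv.neg_apply, sub_neg_eq_add, ← sub_eq_add_neg, mul_comm (qFactInv p (a + r))]

theorem bilatSum_reflect (p : ℂ) : bilatSum p a b c = bilatSum p a b fun r => c (a - b - r) := by
  rw [bilatSum, bilatSum, ← (Equiv.subLeft (a - b)).tsum_eq]
  refine tsum_congr fun r => ?_
  rw [Equiv.subLeft_apply, show a - (a - b - r) = b + r by ring,
    show b + (a - b - r) = a - r by ring, mul_comm (qFactInv p (b + r))]

theorem one_sub_zpow_mul_bilatSum (hp0 : p ≠ 0) (hp : ‖p‖ < 1) :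
    (1 - p ^ (a + b + 1)) * bilatSum p a (b + 1) c =
      bilatSum p a b fun r => c r + p ^ (b + r) * c (r - 1) := by
  -- `1 - X * Y = (1 - Y) + Y * (1 - X)` with `X = p ^ (a - r)` and `Y = p ^ (b + 1 + r)`
  have split (r : ℤ) : (1 - p ^ (a + b + 1)) *
        (c r * (qFactInv p (a - r) * qFactInv p (b + 1 + r))) =
      c r * (qFactInv p (a - r) * qFactInv p (b + r)) +
        p ^ (b + (r + 1)) * c (r + 1 - 1) *
          (qFactInv p (a - (r + 1)) * qFactInv p (b + (r + 1))) := by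
    rw [show b + r = b + 1 + r - 1 by ring, show a - (r + 1) = a - r - 1 by ring,
      show b + (r + 1) = b + 1 + r by ring, qFactInv_sub_one hp, qFactInv_sub_one hp,
      show a + b + 1 = (a - r) + (b + 1 + r) by ring, zpow_add₀ hp0, add_sub_cancel_right]
    ring
  have shifted := summable_bilatSum a b (fun r => p ^ (b + r) * c (r - 1)) p
  rw [bilatSum_add, bilatSum, ← tsum_mul_left, tsum_congr split]
  refine ((summable_bilatSum a b c p).tsum_add
    ((Equiv.addRight (1 : ℤ)).summable_iff.mpr shifted)).trans (congrArg _ ?_)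
  exact (Equiv.addRight (1 : ℤ)).tsum_eq fun r =>
    p ^ (b + r) * c (r - 1) * (qFactInv p (a - r) * qFactInv p (b + r))

variable {a b c}

theorem tendsto_bilatSum (hp : ‖p‖ < 1) (hc : Summable (‖c ·‖)) {a b : ℕ → ℤ} {L : ℤ → ℂ}
    (hL : ∀ r, Tendsto (fun n => qFactInv p (a n - r) * qFactInv p (b n + r)) atTop (𝓝 (L r))) :
    Tendsto (fun n => bilatSum p (a n) (b n) c) atTop (𝓝 (∑' r, c r * L r)) := by
  obtain ⟨C, hC0, hC⟩ := exists_norm_qFactInv_le hp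
  refine tendsto_tsum_of_dominated_convergence (hc.mul_right (C * C))
    (fun r => (hL r).const_mul (c r)) (Eventually.of_forall fun n r => ?_)
  rw [norm_mul, norm_mul]
  gcongr <;> exact hC _

end

/-! ### The finite and infinite triple products -/

section

variable {q : ℂ}

theorem one_sub_zpow_ne_zero (hq : ‖q‖ < 1) {k : ℤ} (hk : 0 < k) : 1 - q ^ k ≠ 0 := by
  lift k to ℕ using hk.le
  exact_mod_cast one_sub_ne_zero_of_norm_lt_one (norm_pow_lt_one hq (by omega : k ≠ 0))

theorem one_sub_zpow_mul_bilatSum_zpow_mul_zpow_sq (hq0 : q ≠ 0) (hq : ‖q‖ < 1) {z : ℂ}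
    (hz : z ≠ 0) (a b : ℤ) :
    (1 - (q ^ 2) ^ (a + b + 1)) * bilatSum (q ^ 2) a (b + 1) (fun r => z ^ r * q ^ (r ^ 2)) =
      (1 - -q / z * (q ^ 2) ^ b) * bilatSum (q ^ 2) a b fun r => z ^ r * q ^ (r ^ 2) := by
  rw [one_sub_zpow_mul_bilatSum a b _ (pow_ne_zero 2 hq0) (norm_pow_lt_one hq two_ne_zero),
    ← bilatSum_const_mul]
  congr 1
  funext r
  rw [← zpow_natCast q 2, ← zpow_mul, ← zpow_mul, zpow_sub_one₀ hz,
    show (r - 1) ^ 2 = r ^ 2 - 2 * r + 1 by ring, zpow_add_one₀ hq0, zpow_sub₀ hq0,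
    Nat.cast_ofNat, mul_add, zpow_add₀ hq0]
  field_simp
  ring

theorem bilatSum_zpow_mul_zpow_sq (hq0 : q ≠ 0) (hq : ‖q‖ < 1) {z : ℂ} (hz : z ≠ 0) (m n : ℕ) :
    bilatSum (q ^ 2) m n (fun r => z ^ r * q ^ (r ^ 2)) =
      qPoch (-z * q) (q ^ 2) m * qPoch (-q / z) (q ^ 2) n * qFactInv (q ^ 2) (m + n) := by
  have hp := norm_pow_lt_one hq two_ne_zero
  have step {z : ℂ} (hz : z ≠ 0) (m n : ℕ)
      (ih : bilatSum (q ^ 2) m n (fun r => z ^ r * q ^ (r ^ 2)) =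
        qPoch (-z * q) (q ^ 2) m * qPoch (-q / z) (q ^ 2) n * qFactInv (q ^ 2) (m + n)) :
      bilatSum (q ^ 2) m (n + 1 : ℕ) (fun r => z ^ r * q ^ (r ^ 2)) =
        qPoch (-z * q) (q ^ 2) m * qPoch (-q / z) (q ^ 2) (n + 1) *
          qFactInv (q ^ 2) (m + (n + 1 : ℕ)) := by
    have fact := qFactInv_sub_one hp (m + n + 1)
    rw [add_sub_cancel_right] at fact
    refine mul_left_cancel₀ (one_sub_zpow_ne_zero hp (by omega : (0 : ℤ) < m + n + 1)) ?_
    rw [Nat.cast_succ, one_sub_zpow_mul_bilatSum_zpow_mul_zpow_sq hq0 hq hz, ih, qPoch_succ, fact,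
      add_assoc, zpow_natCast]
    ring
  have row {z : ℂ} (hz : z ≠ 0) (n : ℕ) :
      bilatSum (q ^ 2) (0 : ℕ) n (fun r => z ^ r * q ^ (r ^ 2)) =
        qPoch (-z * q) (q ^ 2) 0 * qPoch (-q / z) (q ^ 2) n * qFactInv (q ^ 2) ((0 : ℕ) + n) := by
    induction n with
    | zero => simp [bilatSum_zero_zero, qPoch_zero, qFactInv_zero]
    | succ n ih => exact step hz 0 n ih
  induction n with
  | zero =>
    rw [bilatSum_swap]
    simp only [neg_sq, zpow_neg, ← inv_zpow]
    rw [row (inv_ne_zero hz) m, div_inv_eq_mul, add_comm, qPoch_zero, qPoch_zero]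
    ring_nf
  | succ n ih => exact step hz m n ih

theorem eq_qFactInv_of_one_sub_mul_eq (hq : ‖q‖ < 1) {k : ℤ} (hk : 0 < k) {x : ℂ}
    (h : (1 - (q ^ 2) ^ k) * x = (1 + q ^ k) * qFactInv q (k - 1)) : x = qFactInv q k := by
  have hp := norm_pow_lt_one hq two_ne_zero
  refine mul_left_cancel₀ (one_sub_zpow_ne_zero hp hk) (h.trans ?_)
  rw [qFactInv_sub_one hq, show (q ^ 2) ^ k = (q ^ k) ^ 2 by rw [pow_two, mul_zpow, ← pow_two]]
  ring

theorem one_sub_zpow_mul_bilatSum_triangular_odd (hq0 : q ≠ 0) (hq : ‖q‖ < 1) (n : ℤ) :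
    (1 - (q ^ 2) ^ (2 * n + 1)) * bilatSum (q ^ 2) n (n + 1) (fun r => q ^ (2 * r ^ 2 + r)) =
      (1 + q ^ (2 * n + 1)) * bilatSum (q ^ 2) n n fun r => q ^ (2 * r ^ 2 + r) := by
  have coeff : (fun r : ℤ => q ^ (2 * r ^ 2 + r) +
        (q ^ 2) ^ (n + r) * q ^ (2 * (r - 1) ^ 2 + (r - 1))) =
      fun r => q ^ (2 * r ^ 2 + r) + q ^ (2 * n + 1) * q ^ (2 * (-r) ^ 2 + -r) := by
    funext r
    rw [← zpow_natCast q 2, ← zpow_mul, ← zpow_add₀ hq0, ← zpow_add₀ hq0]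
    push_cast
    ring_nf
  rw [two_mul n, one_sub_zpow_mul_bilatSum n n _ (pow_ne_zero 2 hq0)
    (norm_pow_lt_one hq two_ne_zero), ← two_mul, coeff, bilatSum_add, bilatSum_const_mul,
    ← bilatSum_swap n n fun r => q ^ (2 * r ^ 2 + r)]
  ring

theorem one_sub_zpow_mul_bilatSum_triangular_even (hq0 : q ≠ 0) (hq : ‖q‖ < 1) (n : ℤ) :
    (1 - (q ^ 2) ^ (2 * n + 2)) *
        bilatSum (q ^ 2) (n + 1) (n + 1) (fun r => q ^ (2 * r ^ 2 + r)) =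
      (1 + q ^ (2 * n + 2)) * bilatSum (q ^ 2) n (n + 1) fun r => q ^ (2 * r ^ 2 + r) := by
  have coeff : (fun r : ℤ => q ^ (2 * (-r) ^ 2 + -r) +
        (q ^ 2) ^ (n + r) * q ^ (2 * (-(r - 1)) ^ 2 + -(r - 1))) =
      fun r => q ^ (2 * (-r) ^ 2 + -r) +
        q ^ (2 * n + 2) * q ^ (2 * (r - 1) ^ 2 + (r - 1)) := by
    funext r
    rw [← zpow_natCast q 2, ← zpow_mul, ← zpow_add₀ hq0, ← zpow_add₀ hq0]
    push_cast
    ring_nf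
  have reflect : bilatSum (q ^ 2) (n + 1) n (fun r => q ^ (2 * (r - 1) ^ 2 + (r - 1))) =
      bilatSum (q ^ 2) (n + 1) n fun r => q ^ (2 * (-r) ^ 2 + -r) := by
    rw [bilatSum_reflect]
    ring_nf
  rw [bilatSum_swap, show 2 * n + 2 = n + 1 + n + 1 by ring,
    one_sub_zpow_mul_bilatSum _ _ _ (pow_ne_zero 2 hq0) (norm_pow_lt_one hq two_ne_zero),
    show n + 1 + n + 1 = 2 * n + 2 by ring, coeff, bilatSum_add, bilatSum_const_mul, reflect,
    ← bilatSum_swap n (n + 1) fun r => q ^ (2 * r ^ 2 + r)]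
  ring

theorem bilatSum_triangular (hq0 : q ≠ 0) (hq : ‖q‖ < 1) (n : ℕ) :
    bilatSum (q ^ 2) n n (fun r => q ^ (2 * r ^ 2 + r)) = qFactInv q (2 * n) ∧
      bilatSum (q ^ 2) n (n + 1) (fun r => q ^ (2 * r ^ 2 + r)) = qFactInv q (2 * n + 1) := by
  have odd (n : ℕ) (even : bilatSum (q ^ 2) n n (fun r => q ^ (2 * r ^ 2 + r)) =
        qFactInv q (2 * n)) :
      bilatSum (q ^ 2) n (n + 1) (fun r => q ^ (2 * r ^ 2 + r)) = qFactInv q (2 * n + 1) := by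
    refine eq_qFactInv_of_one_sub_mul_eq hq (by omega) ?_
    rw [one_sub_zpow_mul_bilatSum_triangular_odd hq0 hq, even, add_sub_cancel_right]
  suffices even : bilatSum (q ^ 2) n n (fun r => q ^ (2 * r ^ 2 + r)) = qFactInv q (2 * n) from
    ⟨even, odd n even⟩
  induction n with
  | zero => simp [bilatSum_zero_zero, qFactInv_zero]
  | succ n ih =>
    refine eq_qFactInv_of_one_sub_mul_eq hq (by omega) ?_
    rw [Nat.cast_succ, mul_add, mul_one, one_sub_zpow_mul_bilatSum_triangular_even hq0 hq,
      odd n ih]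
    ring_nf

end

theorem tendsto_qFactInv_natCast_add {p : ℂ} (hp : ‖p‖ < 1) (s : ℤ) :
    Tendsto (fun n : ℕ => qFactInv p (n + s)) atTop (𝓝 (qPochInf p p)⁻¹) :=
  (tendsto_qFactInv hp).comp (tendsto_atTop_add_const_right _ s tendsto_natCast_atTop_atTop)

/-! ### Sums of `q`-hypergeometric type -/

/-- The theta series `∑ z ^ r q ^ (r²)`, over all integers `r`. -/
def thetaSeries (z q : ℂ) : ℂ := ∑' r : ℤ, z ^ r * q ^ (r ^ 2)

section

variable {q : ℂ}

theorem thetaSeries_eq_mul (hq0 : q ≠ 0) (hq : ‖q‖ < 1) {z : ℂ} (hz : z ≠ 0) :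
    thetaSeries z q =
      qPochInf (-z * q) (q ^ 2) * qPochInf (-q / z) (q ^ 2) * qPochInf (q ^ 2) (q ^ 2) := by
  have hp := norm_pow_lt_one hq two_ne_zero
  have hne := qPochInf_ne_zero_of_norm_lt_one hp hp
  have left := tendsto_bilatSum hp (summable_norm_zpow_mul_zpow_sq hq z) (a := Nat.cast)
    (b := Nat.cast) fun r => by
      simpa only [sub_eq_add_neg] using
        (tendsto_qFactInv_natCast_add hp (-r)).mul (tendsto_qFactInv_natCast_add hp r)
  have right := ((tendsto_qPoch hp (-z * q)).mul (tendsto_qPoch hp (-q / z))).mul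
    ((tendsto_qFactInv hp).comp
      (tendsto_natCast_atTop_atTop.atTop_add_atTop tendsto_natCast_atTop_atTop))
  have limits := tendsto_nhds_unique left
    (right.congr fun n => (bilatSum_zpow_mul_zpow_sq hq0 hq hz n n).symm)
  rw [tsum_mul_right, ← mul_inv, ← div_eq_mul_inv, div_eq_iff (mul_ne_zero hne hne)] at limits
  rw [thetaSeries, limits]
  field_simp

theorem summable_norm_pow_mul_pow_sq_mul_qFactInv (hq : ‖q‖ < 1) (y : ℂ) :
    Summable fun n : ℕ => ‖y ^ n * q ^ (n ^ 2) * qFactInv (q ^ 2) n‖ := by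
  obtain ⟨C, -, hC⟩ := exists_norm_qFactInv_le (norm_pow_lt_one hq two_ne_zero)
  refine Summable.of_nonneg_of_le (fun _ => norm_nonneg _) (fun n => ?_)
    ((summable_norm_pow_mul_pow_sq hq y).mul_right C)
  rw [norm_mul]
  gcongr
  exact hC n

theorem tsum_pow_mul_pow_sq_mul_qFactInv (hq0 : q ≠ 0) (hq : ‖q‖ < 1) (y : ℂ) :
    ∑' n : ℕ, y ^ n * q ^ (n ^ 2) * qFactInv (q ^ 2) n = qPochInf (-y * q) (q ^ 2) := by
  have hp := norm_pow_lt_one hq two_ne_zero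
  rcases eq_or_ne y 0 with rfl | hy
  · rw [tsum_eq_single 0 fun n hn => by simp [hn]]
    simp [qFactInv_zero, qPochInf]
  have hne := qPochInf_ne_zero_of_norm_lt_one hp hp
  have left := tendsto_bilatSum hp (summable_norm_zpow_mul_zpow_sq hq y) (a := Nat.cast)
    (b := fun _ => ((0 : ℕ) : ℤ)) fun r => by
      simpa only [sub_eq_add_neg] using
        (tendsto_qFactInv_natCast_add hp (-r)).mul_const (qFactInv (q ^ 2) ((0 : ℕ) + r))
  have right := (tendsto_qPoch hp (-y * q)).mul (tendsto_qFactInv_natCast_add hp 0)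
  have limits := tendsto_nhds_unique left (right.congr fun n => by
    rw [bilatSum_zpow_mul_zpow_sq hq0 hq hy n 0, qPoch_zero, mul_one, Nat.cast_zero])
  simp only [mul_left_comm _ (qPochInf (q ^ 2) (q ^ 2))⁻¹, Nat.cast_zero, zero_add,
    tsum_mul_left] at limits
  rw [mul_comm (qPochInf (-y * q) (q ^ 2))] at limits
  have support : (Function.support fun r : ℤ => y ^ r * q ^ (r ^ 2) * qFactInv (q ^ 2) r) ⊆
      Set.range (Nat.cast : ℕ → ℤ) := fun r hr => by
    by_contra h
    have hr0 : r < 0 := not_le.mp fun h0 => h ⟨r.toNat, Int.toNat_of_nonneg h0⟩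
    exact hr (by simp only [qFactInv_of_neg _ hr0, mul_zero])
  rw [← mul_left_cancel₀ (inv_ne_zero hne) limits, ← Nat.cast_injective.tsum_eq support]
  norm_cast

theorem sum_antidiagonal_qPoch_mul_pow {p : ℂ} (hp : ‖p‖ < 1) (a : ℂ) (N : ℕ) :
    ∑ x ∈ antidiagonal N,
      qPoch a p x.1 * a ^ x.2 * (qFactInv p x.1 * qFactInv p x.2) = qFactInv p N := by
  induction N with
  | zero => simp [qFactInv_zero, qPoch_zero]
  | succ N ih =>
    have fact (n : ℕ) : (1 - p ^ (n + 1)) * qFactInv p (n + 1 : ℕ) = qFactInv p n := by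
      have h := qFactInv_sub_one hp (n + 1)
      rw [add_sub_cancel_right] at h
      rw [h]
      norm_cast
    refine mul_left_cancel₀ (one_sub_ne_zero_of_norm_lt_one (norm_pow_lt_one hp N.succ_ne_zero)) ?_
    have split (x : ℕ × ℕ) (hx : x ∈ antidiagonal (N + 1)) :
        (1 - p ^ (N + 1)) * (qPoch a p x.1 * a ^ x.2 * (qFactInv p x.1 * qFactInv p x.2)) =
        qPoch a p x.1 * a ^ x.2 * ((1 - p ^ x.1) * qFactInv p x.1 * qFactInv p x.2) +
          p ^ x.1 * qPoch a p x.1 * a ^ x.2 *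
            (qFactInv p x.1 * ((1 - p ^ x.2) * qFactInv p x.2)) := by
      rw [← mem_antidiagonal.mp hx, pow_add]
      ring
    rw [fact, Finset.mul_sum, Finset.sum_congr rfl split, Finset.sum_add_distrib,
      Finset.Nat.sum_antidiagonal_succ, Finset.Nat.sum_antidiagonal_succ', ← ih]
    simp only [pow_zero, sub_self, zero_mul, mul_zero, zero_add, fact, ← Finset.sum_add_distrib]
    refine Finset.sum_congr rfl fun x _ => ?_
    rw [qPoch_succ, pow_succ]
    ring

theorem tsum_prod_eq_tsum_sum_antidiagonal {E : Type*} [NormedAddCommGroup E] [CompleteSpace E]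
    {f : ℕ × ℕ → E} (hf : Summable f) :
    ∑' x, f x = ∑' N, ∑ x ∈ antidiagonal N, f x := by
  have hs : Summable (f ∘ Finset.HasAntidiagonal.sigmaAntidiagonalEquivProd) :=
    Finset.HasAntidiagonal.sigmaAntidiagonalEquivProd.summable_iff.mpr hf
  rw [← Finset.HasAntidiagonal.sigmaAntidiagonalEquivProd.tsum_eq]
  exact hs.tsum_sigma.trans (tsum_congr fun N => by rw [← Finset.tsum_subtype]; rfl)

theorem summable_qPoch_mul_pow_mul_qFactInv (hq : ‖q‖ < 1) (a y : ℂ) :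
    Summable fun x : ℕ × ℕ => y ^ x.1 * q ^ (x.1 ^ 2) * qFactInv (q ^ 2) x.1 *
      qPoch a (q ^ 2) x.1 *
        ((a * y * (q ^ 2) ^ x.1) ^ x.2 * q ^ (x.2 ^ 2) * qFactInv (q ^ 2) x.2) := by
  have hp := norm_pow_lt_one hq two_ne_zero
  have hy := summable_norm_pow_mul_pow_sq_mul_qFactInv hq y
  have hay := summable_norm_pow_mul_pow_sq_mul_qFactInv hq (a * y)
  refine Summable.of_norm_bounded ((hy.mul_of_nonneg hay (fun _ => norm_nonneg _)
    fun _ => norm_nonneg _).mul_left (Real.exp (‖a‖ / (1 - ‖q ^ 2‖)))) fun ⟨n, k⟩ => ?_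
  have small : ‖((q ^ 2) ^ n) ^ k‖ ≤ 1 := by
    rw [norm_pow, norm_pow]
    exact pow_le_one₀ (by positivity) (pow_le_one₀ (norm_nonneg _) hp.le)
  calc _ = ‖qPoch a (q ^ 2) n‖ * (‖y ^ n * q ^ (n ^ 2) * qFactInv (q ^ 2) n‖ *
        (‖((q ^ 2) ^ n) ^ k‖ * ‖(a * y) ^ k * q ^ (k ^ 2) * qFactInv (q ^ 2) k‖)) := by
        rw [mul_pow (a * y)]
        simp only [norm_mul]
        ring
    _ ≤ _ := by
      gcongr
      · exact norm_qPoch_le hp a n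
      · exact mul_le_of_le_one_left (norm_nonneg _) small

/-- The `₁φ₁` summation. Expanding the infinite product by Euler's formula turns the left-hand side
into a double series whose antidiagonal sums are finite sums in closed form. -/
theorem tsum_qPoch_mul_qPochInf (hq0 : q ≠ 0) (hq : ‖q‖ < 1) (a y : ℂ) :
    ∑' n : ℕ, y ^ n * q ^ (n ^ 2) * qFactInv (q ^ 2) n * qPoch a (q ^ 2) n *
      qPochInf (-(a * y * (q ^ 2) ^ n) * q) (q ^ 2) = qPochInf (-y * q) (q ^ 2) := by
  have hp := norm_pow_lt_one hq two_ne_zero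
  simp only [← tsum_pow_mul_pow_sq_mul_qFactInv hq0 hq, ← tsum_mul_left]
  have double := summable_qPoch_mul_pow_mul_qFactInv hq a y
  rw [← double.tsum_prod, tsum_prod_eq_tsum_sum_antidiagonal double]
  refine tsum_congr fun N => ?_
  rw [← sum_antidiagonal_qPoch_mul_pow hp a N, Finset.mul_sum]
  refine Finset.sum_congr rfl fun x hx => ?_
  rw [← mem_antidiagonal.mp hx]
  ring

end

/-! ### A limiting case of Bailey's lemma -/

theorem two_mul_bilatSum (p : ℂ) (a b : ℤ) (c : ℤ → ℂ) :
    2 * bilatSum p a b c = bilatSum p a b fun r => c r + c (a - b - r) := by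
  rw [bilatSum_add, ← bilatSum_reflect, two_mul]

theorem tsum_mul_bilatSum {p : ℂ} (hp : ‖p‖ < 1) (a b : ℕ → ℤ) {g : ℕ → ℂ}
    (hg : Summable (‖g ·‖)) {c : ℤ → ℂ} (hc : Summable (‖c ·‖)) :
    ∑' n : ℕ, g n * bilatSum p (a n) (b n) c =
      ∑' r : ℤ, c r * ∑' n : ℕ, g n * (qFactInv p (a n - r) * qFactInv p (b n + r)) := by
  obtain ⟨C, hC0, hC⟩ := exists_norm_qFactInv_le hp
  have double : Summable (Function.uncurry fun (n : ℕ) (r : ℤ) =>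
      g n * (c r * (qFactInv p (a n - r) * qFactInv p (b n + r)))) := by
    refine Summable.of_norm_bounded ((hg.mul_of_nonneg hc (fun _ => norm_nonneg _)
      fun _ => norm_nonneg _).mul_right (C * C)) fun ⟨n, r⟩ => ?_
    simp only [Function.uncurry_apply_pair, norm_mul]
    rw [mul_assoc]
    gcongr <;> exact hC _
  simp only [bilatSum, ← tsum_mul_left]
  rw [← double.tsum_comm]
  exact tsum_congr fun r => tsum_congr fun n => by ring

/-- The weight `(-q ^ (1 + δ) / w; q ^ 2)_n w ^ n q ^ (n ^ 2 + δ n)`: in the case of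
Bailey's lemma where one parameter is `-q ^ (1 + δ) / w` and the other one tends to infinity, this
is the sequence paired with a Bailey pair relative to `q ^ (2 δ)`. -/
def baileyWeight (q w : ℂ) (δ n : ℕ) : ℂ :=
  qPoch (-q ^ (1 + δ) / w) (q ^ 2) n * w ^ n * q ^ (n ^ 2 + δ * n)

/-- The conjugate Bailey sequence of the weight `baileyWeight q w δ`, that is, the sum over `n` of
`baileyWeight q w δ n / ((q ^ 2; q ^ 2)_{n - r} (q ^ 2; q ^ 2)_{n + δ + r})`. -/
def baileySum (q w : ℂ) (δ : ℕ) (r : ℤ) : ℂ :=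
  ∑' n : ℕ, baileyWeight q w δ n * (qFactInv (q ^ 2) (n - r) * qFactInv (q ^ 2) (n + δ + r))

section

variable {q : ℂ} {δ : ℕ}

theorem summable_norm_baileyWeight (hq : ‖q‖ < 1) (w : ℂ) (δ : ℕ) :
    Summable (‖baileyWeight q w δ ·‖) := by
  refine Summable.of_nonneg_of_le (fun _ => norm_nonneg _) (fun n => ?_)
    ((summable_norm_pow_mul_pow_sq hq (w * q ^ δ)).mul_left
      (Real.exp (‖-q ^ (1 + δ) / w‖ / (1 - ‖q ^ 2‖))))
  calc ‖baileyWeight q w δ n‖ = ‖qPoch (-q ^ (1 + δ) / w) (q ^ 2) n‖ *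
        ‖(w * q ^ δ) ^ n * q ^ (n ^ 2)‖ := by
        rw [← norm_mul, baileyWeight]
        ring_nf
    _ ≤ _ := by
      gcongr
      exact norm_qPoch_le (norm_pow_lt_one hq two_ne_zero) _ n

theorem tsum_baileyWeight_mul_bilatSum (hq : ‖q‖ < 1) (w : ℂ) (δ : ℕ) {c : ℤ → ℂ}
    (hc : Summable (‖c ·‖)) :
    ∑' n : ℕ, baileyWeight q w δ n * bilatSum (q ^ 2) n (n + δ) c =
      ∑' r : ℤ, c r * baileySum q w δ r :=
  tsum_mul_bilatSum (norm_pow_lt_one hq two_ne_zero) _ _ (summable_norm_baileyWeight hq w δ) hc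

theorem baileySum_reflect (q w : ℂ) (δ : ℕ) (r : ℤ) :
    baileySum q w δ (-r - δ) = baileySum q w δ r := by
  refine tsum_congr fun n => ?_
  rw [show (n : ℤ) - (-r - δ) = n + δ + r by ring, show (n : ℤ) + δ + (-r - δ) = n - r by ring,
    mul_comm (qFactInv (q ^ 2) (n - r))]

theorem baileySum_natCast (hq0 : q ≠ 0) (hq : ‖q‖ < 1) {w : ℂ} (hw : w ≠ 0) (δ r : ℕ) :
    baileySum q w δ r = baileyWeight q w δ r * qPochInf (-w * q ^ (2 * r + δ + 1)) (q ^ 2) /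
      qPochInf (q ^ 2) (q ^ 2) := by
  have hp := norm_pow_lt_one hq two_ne_zero
  have support : Function.support (fun n : ℕ => baileyWeight q w δ n *
      (qFactInv (q ^ 2) ((n : ℤ) - (r : ℕ)) * qFactInv (q ^ 2) ((n : ℤ) + δ + (r : ℕ)))) ⊆
      Set.range (· + r) := fun n hn => by
    by_contra h
    have hlt : n < r := not_le.mp fun hle => h ⟨n - r, Nat.sub_add_cancel hle⟩
    exact hn (by simp only [qFactInv_of_neg (q ^ 2) (by omega : (n : ℤ) - r < 0), zero_mul,
      mul_zero])
  rw [baileySum, ← (add_left_injective r).tsum_eq support,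
    show -w * q ^ (2 * r + δ + 1) = -(w * q ^ (2 * r + δ)) * q by ring,
    ← tsum_qPoch_mul_qPochInf hq0 hq (-q ^ (1 + δ) / w * (q ^ 2) ^ r), mul_div_right_comm,
    ← tsum_mul_left]
  refine tsum_congr fun m => ?_
  have argument : -(-q ^ (1 + δ) / w * (q ^ 2) ^ r * (w * q ^ (2 * r + δ)) * (q ^ 2) ^ m) * q =
      q ^ 2 * (q ^ 2) ^ (m + 2 * r + δ) := by
    field_simp
    ring
  rw [show ((m + r : ℕ) : ℤ) - (r : ℕ) = m by push_cast; ring,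
    show ((m + r : ℕ) : ℤ) + δ + (r : ℕ) = (m + 2 * r + δ : ℕ) by push_cast; ring,
    qFactInv_natCast_eq_div hp (m + 2 * r + δ), argument, baileyWeight, baileyWeight,
    add_comm m r, qPoch_add]
  ring

theorem baileySum_eq_of_natCast (hδ : δ ≤ 1) {w : ℂ} {f : ℤ → ℂ} (hf : ∀ r, f (-r - δ) = f r)
    (h : ∀ r : ℕ, baileySum q w δ r = f r) : baileySum q w δ = f := by
  ext r
  rcases le_or_gt 0 r with hr | hr
  · lift r to ℕ using hr
    exact h r
  · obtain ⟨n, hn⟩ := Int.eq_ofNat_of_zero_le (by omega : 0 ≤ -r - δ)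
    rw [← baileySum_reflect, ← hf, hn]
    exact h n

theorem one_add_zpow_ne_zero (hq : ‖q‖ < 1) (k : ℤ) : 1 + q ^ k ≠ 0 := by
  wlog hk : 0 ≤ k generalizing k
  · intro h
    have h1 : q ^ k = -1 := by linear_combination h
    exact this (-k) (by omega) (by rw [zpow_neg, h1]; norm_num)
  lift k to ℕ using hk
  rw [zpow_natCast]
  rcases eq_or_ne k 0 with rfl | hk
  · norm_num
  · exact one_add_ne_zero_of_norm_lt_one (norm_pow_lt_one hq hk)

theorem baileySum_one (hq0 : q ≠ 0) (hq : ‖q‖ < 1) (hδ : δ ≤ 1) :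
    baileySum q 1 δ = fun r : ℤ =>
      qPochInf (-q ^ (1 + δ)) (q ^ 2) / qPochInf (q ^ 2) (q ^ 2) * q ^ (r ^ 2 + δ * r) := by
  refine baileySum_eq_of_natCast hδ (fun r => ?_) (fun r => ?_)
  · ring_nf
  · rw [baileySum_natCast hq0 hq one_ne_zero, baileyWeight,
      show -1 * q ^ (2 * r + δ + 1) = -q ^ (1 + δ) * (q ^ 2) ^ r by ring,
      qPochInf_eq_qPoch_mul (norm_pow_lt_one hq two_ne_zero) (-q ^ (1 + δ)) r, div_one, one_pow]
    norm_cast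
    ring

theorem baileySum_self (hq0 : q ≠ 0) (hq : ‖q‖ < 1) (hδ : δ ≤ 1) :
    baileySum q q δ = fun r : ℤ => qPochInf (-q ^ δ) (q ^ 2) / qPochInf (q ^ 2) (q ^ 2) *
      (q ^ (r ^ 2 + δ * r + r) / (1 + q ^ (2 * r + δ))) := by
  refine baileySum_eq_of_natCast hδ (fun r => ?_) (fun r => ?_)
  · congr 1
    rw [div_eq_div_iff (one_add_zpow_ne_zero hq _) (one_add_zpow_ne_zero hq _), mul_add, mul_add,
      ← zpow_add₀ hq0, ← zpow_add₀ hq0]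
    ring_nf
  · have hp := norm_pow_lt_one hq two_ne_zero
    have hne : 1 + q ^ (2 * r + δ) ≠ 0 := by exact_mod_cast one_add_zpow_ne_zero hq (2 * r + δ)
    have base : -q ^ (1 + δ) / q = -q ^ δ := by
      field_simp
      ring
    have tail : qPochInf (-q ^ δ * (q ^ 2) ^ r) (q ^ 2) =
        (1 + q ^ (2 * r + δ)) * qPochInf (-q * q ^ (2 * r + δ + 1)) (q ^ 2) := by
      rw [qPochInf_eq_mul hp]
      ring_nf
    rw [baileySum_natCast hq0 hq hq0, baileyWeight, base, qPochInf_eq_qPoch_mul hp (-q ^ δ) r, tail]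
    norm_cast
    field_simp
    ring

theorem baileySum_inv (hq0 : q ≠ 0) (hq : ‖q‖ < 1) (hδ : δ ≤ 1) :
    baileySum q q⁻¹ δ = fun r : ℤ => qPochInf (-q ^ (δ + 2)) (q ^ 2) / qPochInf (q ^ 2) (q ^ 2) *
      ((1 + q ^ (2 * r + δ)) * q ^ (r ^ 2 + δ * r - r)) := by
  refine baileySum_eq_of_natCast hδ (fun r => ?_) (fun r => ?_)
  · congr 1
    rw [add_mul, add_mul, one_mul, one_mul, ← zpow_add₀ hq0, ← zpow_add₀ hq0]
    ring_nf
  · have hp := norm_pow_lt_one hq two_ne_zero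
    have base : -q ^ (1 + δ) / q⁻¹ = -q ^ (δ + 2) := by
      field_simp
      ring
    have arg : -q⁻¹ * q ^ (2 * r + δ + 1) = -q ^ (2 * r + δ) := by
      field_simp
      ring
    have tail : qPochInf (-q ^ (2 * r + δ)) (q ^ 2) =
        (1 + q ^ (2 * r + δ)) * qPochInf (-q ^ (δ + 2) * (q ^ 2) ^ r) (q ^ 2) := by
      rw [qPochInf_eq_mul hp]
      ring_nf
    rw [baileySum_natCast hq0 hq (inv_ne_zero hq0), baileyWeight, base, arg, tail,
      qPochInf_eq_qPoch_mul hp (-q ^ (δ + 2)) r, zpow_sub₀ hq0]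
    norm_cast
    rw [inv_pow]
    ring

theorem tsum_baileyWeight_one_mul_bilatSum (hq0 : q ≠ 0) (hq : ‖q‖ < 1) (hδ : δ ≤ 1) {c : ℤ → ℂ}
    (hc : Summable (‖c ·‖)) :
    ∑' n : ℕ, baileyWeight q 1 δ n * bilatSum (q ^ 2) n (n + δ) c =
      qPochInf (-q ^ (1 + δ)) (q ^ 2) / qPochInf (q ^ 2) (q ^ 2) *
        ∑' r : ℤ, c r * q ^ (r ^ 2 + δ * r) := by
  rw [tsum_baileyWeight_mul_bilatSum hq 1 δ hc, ← tsum_mul_left]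
  exact tsum_congr fun r => by rw [baileySum_one hq0 hq hδ, mul_left_comm]

theorem tsum_baileyWeight_inv_mul_bilatSum (hq0 : q ≠ 0) (hq : ‖q‖ < 1) (hδ : δ ≤ 1) {c : ℤ → ℂ}
    (hc : Summable (‖c ·‖)) :
    ∑' n : ℕ, baileyWeight q q⁻¹ δ n * bilatSum (q ^ 2) n (n + δ) c =
      qPochInf (-q ^ (δ + 2)) (q ^ 2) / qPochInf (q ^ 2) (q ^ 2) *
        ∑' r : ℤ, c r * ((1 + q ^ (2 * r + δ)) * q ^ (r ^ 2 + δ * r - r)) := by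
  rw [tsum_baileyWeight_mul_bilatSum hq q⁻¹ δ hc, ← tsum_mul_left]
  exact tsum_congr fun r => by rw [baileySum_inv hq0 hq hδ, mul_left_comm]

/-- The sequence `baileySum q q δ` is not a Gaussian, but it is invariant under `r ↦ -r - δ`, so
the coefficients may be symmetrized, which cancels the denominator. -/
theorem tsum_baileyWeight_self_mul_bilatSum (hq0 : q ≠ 0) (hq : ‖q‖ < 1) (hδ : δ ≤ 1)
    {c d : ℤ → ℂ} (hc : Summable (‖c ·‖))
    (hd : ∀ r, c r + c (-r - δ) = (1 + q ^ (2 * r + δ)) * d r) :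
    ∑' n : ℕ, baileyWeight q q δ n * bilatSum (q ^ 2) n (n + δ) c =
      qPochInf (-q ^ δ) (q ^ 2) / qPochInf (q ^ 2) (q ^ 2) / 2 *
        ∑' r : ℤ, d r * q ^ (r ^ 2 + δ * r + r) := by
  have hsymm : Summable fun r : ℤ => ‖c r + c (-r - δ)‖ := by
    have reflected := (Equiv.subLeft (-(δ : ℤ))).summable_iff.mpr hc
    refine Summable.of_nonneg_of_le (fun _ => norm_nonneg _) (fun r => ?_) (hc.add reflected)
    rw [Function.comp_apply, Equiv.subLeft_apply, show -(δ : ℤ) - r = -r - δ by ring]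
    exact norm_add_le _ _
  have double (n : ℕ) : bilatSum (q ^ 2) n (n + δ) c =
      bilatSum (q ^ 2) n (n + δ) (fun r => c r + c (-r - δ)) / 2 := by
    rw [eq_div_iff two_ne_zero, mul_comm, two_mul_bilatSum]
    ring_nf
  simp only [double, mul_div_assoc']
  rw [tsum_div_const, tsum_baileyWeight_mul_bilatSum hq q δ hsymm, div_mul_eq_mul_div,
    ← tsum_mul_left]
  congr 1
  refine tsum_congr fun r => ?_
  have hne := one_add_zpow_ne_zero hq (2 * r + δ)
  rw [hd, baileySum_self hq0 hq hδ]
  field_simp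

end

/-! ### Splitting the quadruple series -/

theorem nahmTerm_eq_qFactInv (u v w t q : ℂ) (i j k l : ℕ) :
    nahmTerm u v w t q (i, j, k, l) = u ^ i * v ^ j * w ^ k * t ^ l *
      q ^ ((i : ℤ) ^ 2 + (j : ℤ) ^ 2 + (k : ℤ) ^ 2 + (l : ℤ) ^ 2
              - (i : ℤ) * l - (j : ℤ) * l - (k : ℤ) * l) *
      (qFactInv (q ^ 2) i * qFactInv (q ^ 2) j * qFactInv (q ^ 2) k * qFactInv (q ^ 2) l) := by
  simp only [nahmTerm, qFactInv_natCast, div_eq_mul_inv, mul_inv]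

/-- The quadratic form dominates an eighth of the sum of squares, which is why an eighth root of
the base appears. -/
theorem zpow_quadraticForm_le {s : ℝ} (hs0 : 0 < s) (hs1 : s ≤ 1) (i j k l : ℕ) :
    (s ^ 8) ^ ((i : ℤ) ^ 2 + (j : ℤ) ^ 2 + (k : ℤ) ^ 2 + (l : ℤ) ^ 2
      - (i : ℤ) * l - (j : ℤ) * l - (k : ℤ) * l) ≤ s ^ (i ^ 2 + j ^ 2 + k ^ 2 + l ^ 2) := by
  rw [← zpow_natCast s 8, ← zpow_mul, ← zpow_natCast s (_ + _)]
  refine zpow_le_zpow_right_of_le_one₀ hs0 hs1 ?_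
  push_cast
  nlinarith [sq_nonneg (7 * (i : ℤ) - 4 * l), sq_nonneg (7 * (j : ℤ) - 4 * l),
    sq_nonneg (7 * (k : ℤ) - 4 * l), sq_nonneg (l : ℤ)]

/-- The sum of the terms of `F(u, v, w, t; q ^ 2)` with last index `l`; by Euler's formula the sums
over the other three indices are infinite products. -/
def nahmSlice (u v w t q : ℂ) (l : ℕ) : ℂ :=
  t ^ l * q ^ (l ^ 2) * qFactInv (q ^ 2) l *
    (qPochInf (-(u / q ^ l) * q) (q ^ 2) * (qPochInf (-(v / q ^ l) * q) (q ^ 2) *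
      qPochInf (-(w / q ^ l) * q) (q ^ 2)))

/-- The part of the series `F(u, v, w, t; q ^ 2)` with last index `2 n + δ`. -/
def nahmHalf (u v w t q : ℂ) (δ : ℕ) : ℂ := ∑' n : ℕ, nahmSlice u v w t q (2 * n + δ)

section

variable {q : ℂ}

theorem summable_nahmTerm (hq0 : q ≠ 0) (hq : ‖q‖ < 1) (u v w t : ℂ) :
    Summable (nahmTerm u v w t q) := by
  obtain ⟨C, hC0, hC⟩ := exists_norm_qFactInv_le (norm_pow_lt_one hq two_ne_zero)
  have hpos : 0 < ‖q‖ := norm_pos_iff.mpr hq0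
  obtain ⟨s, hs0, hs1, hs⟩ : ∃ s : ℝ, 0 < s ∧ s < 1 ∧ s ^ 8 = ‖q‖ :=
    ⟨‖q‖ ^ ((8 : ℕ) : ℝ)⁻¹, by positivity, Real.rpow_lt_one hpos.le hq (by positivity),
      Real.rpow_inv_natCast_pow hpos.le (by norm_num)⟩
  have gauss (x : ℂ) : Summable fun n : ℕ => ‖x‖ ^ n * s ^ (n ^ 2) := by
    simpa using summable_pow_mul_pow_sq ‖x‖ hs0.le hs1
  have gauss_nonneg (x : ℂ) (n : ℕ) : 0 ≤ ‖x‖ ^ n * s ^ (n ^ 2) := by positivity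
  have dominant := (gauss u).mul_of_nonneg ((gauss v).mul_of_nonneg ((gauss w).mul_of_nonneg
    (gauss t) (gauss_nonneg w) (gauss_nonneg t)) (gauss_nonneg v)
    fun x => mul_nonneg (gauss_nonneg w _) (gauss_nonneg t _)) (gauss_nonneg u)
    fun x => mul_nonneg (gauss_nonneg v _) (mul_nonneg (gauss_nonneg w _) (gauss_nonneg t _))
  refine Summable.of_norm_bounded (dominant.mul_right (C * C * C * C)) fun ⟨i, j, k, l⟩ => ?_
  rw [nahmTerm_eq_qFactInv]
  simp only [norm_mul, norm_pow, norm_zpow, ← hs]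
  calc _ ≤ ‖u‖ ^ i * ‖v‖ ^ j * ‖w‖ ^ k * ‖t‖ ^ l * s ^ (i ^ 2 + j ^ 2 + k ^ 2 + l ^ 2) *
        (C * C * C * C) := by
        gcongr
        exacts [zpow_quadraticForm_le hs0 hs1.le i j k l, hC _, hC _, hC _, hC _]
    _ = _ := by ring

theorem nahmTerm_eq_mul (hq0 : q ≠ 0) (u v w t : ℂ) (i j k l : ℕ) :
    nahmTerm u v w t q (i, j, k, l) = t ^ l * q ^ (l ^ 2) * qFactInv (q ^ 2) l *
      (((u / q ^ l) ^ i * q ^ (i ^ 2) * qFactInv (q ^ 2) i) *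
        (((v / q ^ l) ^ j * q ^ (j ^ 2) * qFactInv (q ^ 2) j) *
          ((w / q ^ l) ^ k * q ^ (k ^ 2) * qFactInv (q ^ 2) k))) := by
  rw [nahmTerm_eq_qFactInv, zpow_sub₀ hq0, zpow_sub₀ hq0, zpow_sub₀ hq0, zpow_add₀ hq0,
    zpow_add₀ hq0, zpow_add₀ hq0]
  simp only [← Nat.cast_pow, ← Nat.cast_mul, zpow_natCast, div_pow, ← pow_mul, mul_comm l]
  ring

theorem hasSum_nahmSlice (hq0 : q ≠ 0) (hq : ‖q‖ < 1) (u v w t : ℂ) :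
    HasSum (nahmSlice u v w t q) (nahmF u v w t q) := by
  let lastFirst : ℕ × ℕ × ℕ × ℕ ≃ ℕ × ℕ × ℕ × ℕ :=
    ⟨fun n => (n.2.1, n.2.2.1, n.2.2.2, n.1), fun n => (n.2.2.2, n.1, n.2.1, n.2.2.1),
      fun _ => rfl, fun _ => rfl⟩
  have summable := lastFirst.summable_iff.mpr (summable_nahmTerm hq0 hq u v w t)
  have slice (l : ℕ) : ∑' n : ℕ × ℕ × ℕ, nahmTerm u v w t q (lastFirst (l, n)) =
      nahmSlice u v w t q l := by
    have hu := summable_norm_pow_mul_pow_sq_mul_qFactInv hq (u / q ^ l)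
    have hv := summable_norm_pow_mul_pow_sq_mul_qFactInv hq (v / q ^ l)
    have hw := summable_norm_pow_mul_pow_sq_mul_qFactInv hq (w / q ^ l)
    simp only [nahmSlice, ← tsum_pow_mul_pow_sq_mul_qFactInv hq0 hq]
    rw [tsum_mul_tsum_of_summable_norm hv hw, tsum_mul_tsum_of_summable_norm hu (hv.mul_norm hw),
      ← tsum_mul_left]
    exact tsum_congr fun n => nahmTerm_eq_mul hq0 u v w t _ _ _ _
  rw [nahmF, ← lastFirst.tsum_eq, ← funext slice]
  exact summable.hasSum.prod_fiberwise fun l => (summable.prod_factor l).hasSum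

theorem nahmF_rotate (hq0 : q ≠ 0) (hq : ‖q‖ < 1) (u v w t : ℂ) :
    nahmF u v w t q = nahmF v w u t q := by
  rw [← (hasSum_nahmSlice hq0 hq u v w t).tsum_eq, ← (hasSum_nahmSlice hq0 hq v w u t).tsum_eq]
  exact tsum_congr fun l => by simp only [nahmSlice]; ring

theorem nahmF_eq_add (hq0 : q ≠ 0) (hq : ‖q‖ < 1) (u v w t : ℂ) :
    nahmF u v w t q = nahmHalf u v w t q 0 + nahmHalf u v w t q 1 := by
  have slices := hasSum_nahmSlice hq0 hq u v w t
  rw [← slices.tsum_eq, ← tsum_even_add_odd]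
  · rfl
  · exact slices.summable.comp_injective (mul_right_injective₀ two_ne_zero)
  · exact slices.summable.comp_injective
      ((add_left_injective 1).comp (mul_right_injective₀ two_ne_zero))

theorem qPochInf_div_pow_mul (hq0 : q ≠ 0) (hq : ‖q‖ < 1) {x : ℂ} (hx : x ≠ 0) (n δ : ℕ) :
    qPochInf (-(x / q ^ (2 * n + δ)) * q) (q ^ 2) * q ^ (n ^ 2 + δ * n) =
      qPochInf (-x * q / q ^ δ) (q ^ 2) * (qPoch (-q ^ (1 + δ) / x) (q ^ 2) n * x ^ n) := by
  have base_ne : -x * q / q ^ δ ≠ 0 :=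
    div_ne_zero (mul_ne_zero (neg_ne_zero.mpr hx) hq0) (pow_ne_zero δ hq0)
  have reversed := qPoch_div_pow_mul hq0 base_ne n
  rw [show q ^ 2 / (-x * q / q ^ δ) = -q ^ (1 + δ) / x by field_simp; ring, pow_add] at reversed
  have powers : (-(-x * q / q ^ δ)) ^ n * q ^ (δ * n) = x ^ n * q ^ n := by
    rw [pow_mul, ← mul_pow, ← mul_pow]
    field_simp
  rw [show -(x / q ^ (2 * n + δ)) * q = -x * q / q ^ δ / (q ^ 2) ^ n by
      rw [pow_add, ← pow_mul]; field_simp,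
    qPochInf_eq_qPoch_mul (norm_pow_lt_one hq two_ne_zero) _ n,
    div_mul_cancel₀ _ (pow_ne_zero n (pow_ne_zero 2 hq0)), pow_add]
  refine mul_right_cancel₀ (pow_ne_zero n hq0) ?_
  linear_combination q ^ (δ * n) * qPochInf (-x * q / q ^ δ) (q ^ 2) * reversed +
    qPoch (-q ^ (1 + δ) / x) (q ^ 2) n * qPochInf (-x * q / q ^ δ) (q ^ 2) * powers

theorem nahmSlice_two_mul_add (hq0 : q ≠ 0) (hq : ‖q‖ < 1) {u v w : ℂ} (hu : u ≠ 0)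
    (hv : v ≠ 0) (hw : w ≠ 0) (t : ℂ) (n δ : ℕ) :
    nahmSlice u v w t q (2 * n + δ) = t ^ δ * q ^ (δ ^ 2) *
      (qPochInf (-u * q / q ^ δ) (q ^ 2) * qPochInf (-v * q / q ^ δ) (q ^ 2) *
        qPochInf (-w * q / q ^ δ) (q ^ 2)) *
      (baileyWeight q w δ n * ((u * v * t ^ 2) ^ n * (qPoch (-q ^ (1 + δ) / u) (q ^ 2) n *
        qPoch (-q ^ (1 + δ) / v) (q ^ 2) n * qFactInv (q ^ 2) (2 * n + δ)))) := by
  have expand (x y z : ℂ) : t ^ (2 * n + δ) * q ^ ((2 * n + δ) ^ 2) *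
        qFactInv (q ^ 2) (2 * n + δ : ℕ) * (x * (y * z)) =
      t ^ δ * (t ^ 2) ^ n * q ^ (δ ^ 2) * q ^ (n ^ 2 + δ * n) * qFactInv (q ^ 2) (2 * n + δ : ℕ) *
        ((x * q ^ (n ^ 2 + δ * n)) * (y * q ^ (n ^ 2 + δ * n)) * (z * q ^ (n ^ 2 + δ * n))) := by
    ring
  rw [nahmSlice, expand, qPochInf_div_pow_mul hq0 hq hu, qPochInf_div_pow_mul hq0 hq hv,
    qPochInf_div_pow_mul hq0 hq hw, baileyWeight]
  push_cast
  ring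

theorem nahmHalf_inv (hq0 : q ≠ 0) (hq : ‖q‖ < 1) {u w : ℂ} (hu : u ≠ 0) (hw : w ≠ 0)
    (δ : ℕ) :
    nahmHalf u u⁻¹ w 1 q δ = q ^ (δ ^ 2) *
      (qPochInf (-u * q / q ^ δ) (q ^ 2) * qPochInf (-q ^ (1 + δ) / u) (q ^ 2) *
        qPochInf (-w * q / q ^ δ) (q ^ 2)) *
      ∑' n : ℕ, baileyWeight q w δ n *
        bilatSum (q ^ 2) n (n + δ) fun r => (u * q ^ δ) ^ r * q ^ (r ^ 2) := by
  have hp := norm_pow_lt_one hq two_ne_zero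
  rw [nahmHalf, ← tsum_mul_left]
  refine tsum_congr fun n => ?_
  have hz : u * q ^ δ ≠ 0 := mul_ne_zero hu (pow_ne_zero δ hq0)
  have triple := bilatSum_zpow_mul_zpow_sq hq0 hq hz n (n + δ)
  rw [Nat.cast_add, show (n + (n + δ) : ℤ) = 2 * n + δ by ring,
    show -(u * q ^ δ) * q = -q ^ (1 + δ) / u⁻¹ by rw [div_inv_eq_mul]; ring,
    show -q / (u * q ^ δ) = -u⁻¹ * q / q ^ δ by field_simp] at triple
  have shift : -u⁻¹ * q / q ^ δ * (q ^ 2) ^ δ = -q ^ (1 + δ) / u := by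
    field_simp
    ring
  have exchange : qPochInf (-u⁻¹ * q / q ^ δ) (q ^ 2) * qPoch (-q ^ (1 + δ) / u) (q ^ 2) n =
      qPochInf (-q ^ (1 + δ) / u) (q ^ 2) * qPoch (-u⁻¹ * q / q ^ δ) (q ^ 2) (n + δ) := by
    rw [qPochInf_eq_qPoch_mul hp _ δ, add_comm n δ, qPoch_add, shift]
    ring
  rw [nahmSlice_two_mul_add hq0 hq hu (inv_ne_zero hu) hw, triple, mul_inv_cancel₀ hu]
  simp only [one_pow, one_mul]
  linear_combination q ^ (δ ^ 2) * qPochInf (-u * q / q ^ δ) (q ^ 2) *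
    qPochInf (-w * q / q ^ δ) (q ^ 2) * baileyWeight q w δ n *
    qPoch (-q ^ (1 + δ) / u⁻¹) (q ^ 2) n * qFactInv (q ^ 2) (2 * n + δ) * exchange

theorem qPoch_neg_mul_qFactInv_sq (hq : ‖q‖ < 1) (n : ℕ) :
    qPoch (-q) q n * qFactInv (q ^ 2) n = qFactInv q n := by
  rw [qFactInv_natCast, qFactInv_natCast, ← qPoch_mul_neg, mul_inv, mul_left_comm,
    mul_inv_cancel₀ (qPoch_ne_zero hq (by rwa [norm_neg]) n), mul_one]

theorem nahmHalf_inv_one_sqrt (hq0 : q ≠ 0) (hq : ‖q‖ < 1) {w h : ℂ} (hw : w ≠ 0) (hh : h ^ 2 = q)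
    {δ : ℕ} (hδ : δ ≤ 1) :
    nahmHalf q⁻¹ 1 w h q δ = h ^ δ * qPochInf (-1) q * qPochInf (-w * q / q ^ δ) (q ^ 2) *
      ∑' n : ℕ, baileyWeight q w δ n *
        bilatSum (q ^ 2) n (n + δ) fun r => q ^ (2 * r ^ 2 + r) := by
  have finite (n : ℕ) : qPoch (-q ^ (1 + δ) / q⁻¹) (q ^ 2) n * qPoch (-q ^ (1 + δ) / 1) (q ^ 2) n =
      qPoch (-q ^ (1 + δ)) q (2 * n) := by
    rw [qPoch_mul_length, Finset.prod_range_succ, Finset.prod_range_one, div_inv_eq_mul, pow_zero,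
      mul_one, pow_one, div_one, mul_comm]
  have collect (n : ℕ) : q ^ (δ ^ 2) * (qPochInf (-q⁻¹ * q / q ^ δ) (q ^ 2) *
        qPochInf (-1 * q / q ^ δ) (q ^ 2)) * qPoch (-q ^ (1 + δ)) q (2 * n) =
      qPochInf (-1) q * qPoch (-q) q (2 * n + δ) := by
    have cancel : -q⁻¹ * q = -1 := by field_simp
    rw [qPochInf_eq_mul_sq hq, neg_one_mul, cancel]
    interval_cases δ
    · simp
    · rw [qPoch_succ', qPochInf_eq_mul (norm_pow_lt_one hq two_ne_zero) (-1 / q ^ 1)]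
      field_simp
      ring_nf
  have triangular (n : ℕ) : bilatSum (q ^ 2) n (n + δ) (fun r => q ^ (2 * r ^ 2 + r)) =
      qPoch (-q) q (2 * n + δ) * qFactInv (q ^ 2) (2 * n + δ) := by
    have product := qPoch_neg_mul_qFactInv_sq hq (2 * n + δ)
    push_cast at product
    rw [product]
    obtain ⟨even, odd⟩ := bilatSum_triangular hq0 hq n
    interval_cases δ
    · simpa using even
    · exact_mod_cast odd
  rw [nahmHalf, ← tsum_mul_left]
  refine tsum_congr fun n => ?_
  rw [nahmSlice_two_mul_add hq0 hq (inv_ne_zero hq0) one_ne_zero hw, finite, triangular, hh,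
    mul_one, inv_mul_cancel₀ hq0, one_pow]
  linear_combination h ^ δ * qPochInf (-w * q / q ^ δ) (q ^ 2) * baileyWeight q w δ n *
    qFactInv (q ^ 2) (2 * n + δ) * collect n

end

/-! ### Theta series and eta quotients -/

section

variable {q : ℂ}

theorem zpow_natCast_mul_sq_add (hq0 : q ≠ 0) (m a : ℕ) (r : ℤ) :
    q ^ (m * r ^ 2 + a * r) = (q ^ a) ^ r * (q ^ m) ^ (r ^ 2) := by
  rw [← zpow_natCast q a, ← zpow_natCast q m, ← zpow_mul, ← zpow_mul, ← zpow_add₀ hq0, add_comm]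

theorem tsum_zpow_natCast_mul_sq_add (hq0 : q ≠ 0) (m a : ℕ) :
    ∑' r : ℤ, q ^ (m * r ^ 2 + a * r) = thetaSeries (q ^ a) (q ^ m) :=
  tsum_congr (zpow_natCast_mul_sq_add hq0 m a)

theorem summable_norm_zpow_natCast_mul_sq_add (hq0 : q ≠ 0) (hq : ‖q‖ < 1) {m : ℕ} (hm : m ≠ 0)
    (a : ℕ) : Summable fun r : ℤ => ‖q ^ (m * r ^ 2 + a * r)‖ := by
  simpa only [zpow_natCast_mul_sq_add hq0] using
    summable_norm_zpow_mul_zpow_sq (norm_pow_lt_one hq hm) (q ^ a)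

theorem tsum_int_even_add_odd {E : Type*} [AddCommGroup E] [UniformSpace E] [IsUniformAddGroup E]
    [CompleteSpace E] [T2Space E] {f : ℤ → E} (hf : Summable f) :
    ∑' r, f r = ∑' k, f (2 * k) + ∑' k, f (-(2 * k + 1)) := by
  have even_injective : Function.Injective fun k : ℤ => 2 * k :=
    mul_right_injective₀ two_ne_zero
  have odd_injective : Function.Injective fun k : ℤ => -(2 * k + 1) :=
    neg_injective.comp ((add_left_injective 1).comp even_injective)
  have range_even : (Set.range fun k : ℤ => 2 * k) = {r | Even r} :=
    Set.ext fun r => by simp [even_iff_exists_two_mul]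
  have range_odd : (Set.range fun k : ℤ => -(2 * k + 1)) = {r | Odd r} := by
    refine Set.ext fun r => ⟨?_, ?_⟩ <;> rintro ⟨k, rfl⟩ <;> exact ⟨-k - 1, by ring⟩
  have evens := even_injective.hasSum_range_iff.mpr (hf.comp_injective even_injective).hasSum
  have odds := odd_injective.hasSum_range_iff.mpr (hf.comp_injective odd_injective).hasSum
  exact (evens.add_isCompl (range_even ▸ range_odd ▸ Int.isCompl_even_odd) odds).tsum_eq

theorem thetaSeries_eq_add (hq0 : q ≠ 0) (hq : ‖q‖ < 1) {z : ℂ} (hz : z ≠ 0) :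
    thetaSeries z q =
      thetaSeries (z ^ 2) (q ^ 4) + q / z * thetaSeries (q ^ 4 / z ^ 2) (q ^ 4) := by
  rw [thetaSeries, tsum_int_even_add_odd (summable_norm_zpow_mul_zpow_sq hq z).of_norm,
    thetaSeries, thetaSeries, ← tsum_mul_left]
  congr 1 <;> refine tsum_congr fun k => ?_
  · rw [mul_pow, zpow_mul, zpow_mul, zpow_ofNat, show (2 : ℤ) ^ 2 = 4 from rfl, zpow_ofNat]
  · rw [show (-(2 * k + 1)) ^ 2 = 1 + 4 * k + 4 * k ^ 2 by ring, zpow_add₀ hq0, zpow_add₀ hq0,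
      zpow_neg, zpow_add₀ hz]
    simp only [zpow_mul, zpow_ofNat, div_zpow]
    ring

theorem qJ_ne_zero (hq : ‖q‖ < 1) {m : ℕ} (hm : m ≠ 0) : qJ q m ≠ 0 :=
  qPochInf_ne_zero_of_norm_lt_one (norm_pow_lt_one hq hm) (norm_pow_lt_one hq hm)

theorem qJ_pow (q : ℂ) (k m : ℕ) : qJ (q ^ k) m = qJ q (k * m) := by
  rw [qJ, qJ, pow_mul]

theorem qPochInf_neg_self (hq : ‖q‖ < 1) {m : ℕ} (hm : m ≠ 0) :
    qPochInf (-q ^ m) (q ^ m) = qJ q (2 * m) / qJ q m := by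
  rw [eq_div_iff (qJ_ne_zero hq hm), mul_comm, qJ, qPochInf_mul_neg (norm_pow_lt_one hq hm),
    ← pow_mul, mul_comm m, qJ]

theorem qPochInf_neg_one (hq : ‖q‖ < 1) {m : ℕ} (hm : m ≠ 0) :
    qPochInf (-1) (q ^ m) = 2 * (qJ q (2 * m) / qJ q m) := by
  rw [qPochInf_eq_mul (norm_pow_lt_one hq hm), neg_one_mul, qPochInf_neg_self hq hm]
  norm_num

theorem qPochInf_pow_two_mul (hq : ‖q‖ < 1) {m : ℕ} (hm : m ≠ 0) :
    qPochInf (q ^ m) (q ^ (2 * m)) = qJ q m / qJ q (2 * m) := by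
  rw [eq_div_iff (qJ_ne_zero hq (by omega)), qJ, qJ,
    qPochInf_eq_mul_sq (norm_pow_lt_one hq hm) (q ^ m), ← pow_add, ← pow_mul, mul_comm m 2,
    two_mul m]

theorem qPochInf_neg_pow_two_mul (hq : ‖q‖ < 1) {m : ℕ} (hm : m ≠ 0) :
    qPochInf (-q ^ m) (q ^ (2 * m)) = qJ q (2 * m) ^ 2 / (qJ q m * qJ q (4 * m)) := by
  have split := qPochInf_eq_mul_sq (norm_pow_lt_one hq hm) (-q ^ m)
  rw [qPochInf_neg_self hq hm, neg_mul, ← pow_add, ← two_mul, ← pow_mul, mul_comm m,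
    qPochInf_neg_self hq (by omega), ← mul_assoc 2 2] at split
  have ne₁ := qJ_ne_zero hq hm
  have ne₂ := qJ_ne_zero hq (by omega : 2 * m ≠ 0)
  have ne₄ := qJ_ne_zero hq (by omega : 2 * 2 * m ≠ 0)
  field_simp at split ⊢
  linear_combination -split

theorem qJ_neg_of_even (q : ℂ) {m : ℕ} (hm : Even m) : qJ (-q) m = qJ q m := by
  rw [qJ, hm.neg_pow, qJ]

theorem qJ_neg_of_odd (hq : ‖q‖ < 1) {m : ℕ} (hm : Odd m) :
    qJ (-q) m = qJ q (2 * m) ^ 3 / (qJ q m * qJ q (4 * m)) := by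
  have hneg : ‖-q ^ m‖ < 1 := by simpa using norm_pow_lt_one hq hm.pos.ne'
  rw [qJ, hm.neg_pow, qPochInf_eq_mul_sq hneg, neg_mul_neg, neg_sq, ← pow_add, ← pow_mul,
    mul_comm m, ← two_mul, qPochInf_neg_pow_two_mul hq hm.pos.ne', ← qJ]
  ring

theorem thetaSeries_one_pow (hq0 : q ≠ 0) (hq : ‖q‖ < 1) {m : ℕ} (hm : m ≠ 0) :
    thetaSeries 1 (q ^ m) = qJ q (2 * m) ^ 5 / (qJ q m ^ 2 * qJ q (4 * m) ^ 2) := by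
  rw [thetaSeries_eq_mul (pow_ne_zero m hq0) (norm_pow_lt_one hq hm) one_ne_zero, neg_one_mul,
    div_one, ← pow_mul, mul_comm m, qPochInf_neg_pow_two_mul hq hm, ← qJ]
  ring

theorem thetaSeries_pow_self (hq0 : q ≠ 0) (hq : ‖q‖ < 1) {m : ℕ} (hm : m ≠ 0) :
    thetaSeries (q ^ m) (q ^ m) = 2 * (qJ q (4 * m) ^ 2 / qJ q (2 * m)) := by
  have hqm := pow_ne_zero m hq0
  have ne₂ := qJ_ne_zero hq (by omega : 2 * m ≠ 0)
  rw [thetaSeries_eq_mul hqm (norm_pow_lt_one hq hm) hqm, neg_mul, neg_div, div_self hqm, ← pow_add,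
    ← two_mul, ← pow_mul, mul_comm m, qPochInf_neg_self hq (by omega),
    qPochInf_neg_one hq (by omega), ← qJ, ← mul_assoc 2 2]
  field_simp
  norm_num

theorem thetaSeries_pow_two_mul (hq0 : q ≠ 0) (hq : ‖q‖ < 1) {m : ℕ} (hm : m ≠ 0) :
    thetaSeries (q ^ m) (q ^ (2 * m)) = qJ q (2 * m) ^ 2 / qJ q m := by
  have merge := qPochInf_eq_mul_sq (norm_pow_lt_one hq (by omega : 2 * m ≠ 0)) (-q ^ m)
  have ne₄ := qJ_ne_zero hq (by omega : 4 * m ≠ 0)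
  rw [thetaSeries_eq_mul (pow_ne_zero _ hq0) (norm_pow_lt_one hq (by omega)) (pow_ne_zero m hq0),
    neg_div, two_mul m, pow_add, mul_div_cancel_right₀ _ (pow_ne_zero m hq0), ← pow_add, ← two_mul,
    mul_comm (qPochInf _ _), ← merge, qPochInf_neg_pow_two_mul hq hm, ← pow_mul,
    show 2 * m * 2 = 4 * m by ring, ← qJ]
  field_simp

theorem thetaSeries_self_cube (hq0 : q ≠ 0) (hq : ‖q‖ < 1) :
    thetaSeries q (q ^ 3) = qJ q 4 * qJ q 6 ^ 2 / (qJ q 2 * qJ q 12) := by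
  have trisect := qPochInf_eq_mul_cube (norm_pow_lt_one hq two_ne_zero) (-q ^ 2)
  have numerator := qPochInf_neg_self hq two_ne_zero
  have denominator := qPochInf_neg_self hq (by norm_num : 6 ≠ 0)
  ring_nf at trisect numerator denominator
  rw [numerator, denominator] at trisect
  have ne₂ := qJ_ne_zero hq two_ne_zero
  have ne₆ := qJ_ne_zero hq (by norm_num : 6 ≠ 0)
  have ne₁₂ := qJ_ne_zero hq (by norm_num : 12 ≠ 0)
  rw [thetaSeries_eq_mul (pow_ne_zero 3 hq0) (norm_pow_lt_one hq three_ne_zero) hq0,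
    show -q * q ^ 3 = -q ^ 4 by ring, show -q ^ 3 / q = -q ^ 2 by field_simp, ← pow_mul, ← qJ]
  field_simp at trisect ⊢
  linear_combination -qJ q 6 * trisect

theorem thetaSeries_sq_cube (hq0 : q ≠ 0) (hq : ‖q‖ < 1) :
    thetaSeries (q ^ 2) (q ^ 3) =
      qJ q 2 ^ 2 * qJ q 3 * qJ q 12 / (qJ q 1 * qJ q 4 * qJ q 6) := by
  have trisect := qPochInf_eq_mul_cube (norm_pow_lt_one hq two_ne_zero) (-q)
  have numerator := qPochInf_neg_pow_two_mul hq one_ne_zero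
  have denominator := qPochInf_neg_pow_two_mul hq three_ne_zero
  ring_nf at trisect numerator denominator
  rw [numerator, denominator] at trisect
  have ne₁ := qJ_ne_zero hq one_ne_zero
  have ne₃ := qJ_ne_zero hq three_ne_zero
  have ne₄ := qJ_ne_zero hq four_ne_zero
  have ne₆ := qJ_ne_zero hq (by norm_num : 6 ≠ 0)
  have ne₁₂ := qJ_ne_zero hq (by norm_num : 12 ≠ 0)
  rw [thetaSeries_eq_mul (pow_ne_zero 3 hq0) (norm_pow_lt_one hq three_ne_zero) (pow_ne_zero 2 hq0),
    show -q ^ 2 * q ^ 3 = -q ^ 5 by ring, show -q ^ 3 / q ^ 2 = -q by field_simp, ← pow_mul, ← qJ]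
  field_simp at trisect ⊢
  linear_combination -trisect

theorem qJ₂_two_twelve (hq : ‖q‖ < 1) :
    qJ₂ q 2 12 = qJ q 2 * qJ q 12 ^ 2 / (qJ q 4 * qJ q 6) := by
  have trisect := qPochInf_eq_mul_cube (norm_pow_lt_one hq four_ne_zero) (q ^ 2)
  have numerator := qPochInf_pow_two_mul hq two_ne_zero
  have denominator := qPochInf_pow_two_mul hq (by norm_num : 6 ≠ 0)
  ring_nf at trisect numerator denominator
  rw [numerator, denominator] at trisect
  have ne₄ := qJ_ne_zero hq four_ne_zero
  have ne₆ := qJ_ne_zero hq (by norm_num : 6 ≠ 0)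
  have ne₁₂ := qJ_ne_zero hq (by norm_num : 12 ≠ 0)
  rw [qJ₂, show q ^ (((12 : ℕ) : ℤ) - ((2 : ℕ) : ℤ)) = q ^ 10 by norm_cast, ← qJ]
  field_simp at trisect ⊢
  linear_combination -trisect

theorem qJ₂_eq_thetaSeries (hq0 : q ≠ 0) (hq : ‖q‖ < 1) {a b m : ℕ} (hm : m ≠ 0)
    (hab : a + b = m) : qJ₂ q a (2 * m) = thetaSeries (-q ^ b) (q ^ m) := by
  have complement : q ^ (((2 * m : ℕ) : ℤ) - (a : ℤ)) = - -q ^ b * q ^ m := by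
    rw [neg_neg, ← pow_add, ← zpow_natCast]
    congr 1
    omega
  have quotient : -q ^ m / -q ^ b = q ^ a := by
    rw [neg_div_neg_eq, ← hab, pow_add, mul_div_cancel_right₀ _ (pow_ne_zero b hq0)]
  rw [thetaSeries_eq_mul (pow_ne_zero m hq0) (norm_pow_lt_one hq hm)
    (neg_ne_zero.mpr (pow_ne_zero b hq0)), qJ₂, complement, quotient, ← pow_mul, mul_comm m 2]
  ring

/-- Both sides are `θ(s; s ^ 3)` for a square root `s` of `-q`: the left side after separating the
even from the odd indices, the right side by the product formula. -/
theorem qJ₂_five_twelve_sub (hq0 : q ≠ 0) (hq : ‖q‖ < 1) :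
    qJ₂ q 5 12 - q * qJ₂ q 1 12 =
      qJ q 1 * qJ q 4 * qJ q 6 ^ 5 / (qJ q 2 ^ 2 * qJ q 3 ^ 2 * qJ q 12 ^ 2) := by
  obtain ⟨s, hs⟩ : ∃ s : ℂ, s ^ 2 = -q := IsAlgClosed.exists_pow_nat_eq (-q) two_pos
  have hs0 : s ≠ 0 := by rintro rfl; exact hq0 (by simpa using hs)
  have hs1 : ‖s‖ < 1 := by
    rwa [← pow_lt_one_iff_of_nonneg (norm_nonneg s) two_ne_zero, ← norm_pow, hs, norm_neg]
  have hJ (m : ℕ) : qJ s (2 * m) = qJ (-q) m := by rw [← hs, qJ_pow]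
  have product := thetaSeries_self_cube hs0 hs1
  rw [hJ 2, hJ 3, hJ 1, hJ 6] at product
  have dissect := thetaSeries_eq_add (pow_ne_zero 3 hs0) (norm_pow_lt_one hs1 three_ne_zero) hs0
  rw [product, qJ_neg_of_even q even_two, qJ_neg_of_even q (by decide : Even 6),
    qJ_neg_of_odd hq odd_one, qJ_neg_of_odd hq (by decide : Odd 3)] at dissect
  rw [show (s ^ 3) ^ 4 = q ^ 6 by rw [← pow_mul, pow_mul s 2 6, hs, neg_pow]; norm_num,
    show s ^ 3 / s = -q by rw [← hs]; field_simp,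
    show q ^ 6 / s ^ 2 = -q ^ 5 by rw [hs]; field_simp, hs] at dissect
  have theta₅ := qJ₂_eq_thetaSeries hq0 hq (by norm_num : 6 ≠ 0) (by norm_num : 5 + 1 = 6)
  have theta₁ := qJ₂_eq_thetaSeries hq0 hq (by norm_num : 6 ≠ 0) (by norm_num : 1 + 5 = 6)
  norm_num only [pow_one] at theta₅ theta₁ dissect
  rw [theta₅, theta₁, sub_eq_add_neg, ← neg_mul, ← dissect]
  have ne₂ := qJ_ne_zero hq two_ne_zero
  have ne₆ := qJ_ne_zero hq (by norm_num : 6 ≠ 0)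
  field_simp

end

/-! ### Rational powers of the nome -/

section

variable (τ : ℍ)

theorem qPow_ne_zero (r : ℚ) : qPow τ r ≠ 0 := Complex.exp_ne_zero _

theorem qPow_add (r s : ℚ) : qPow τ (r + s) = qPow τ r * qPow τ s := by
  rw [qPow, qPow, qPow, ← Complex.exp_add]
  push_cast
  ring_nf

theorem qPow_neg (r : ℚ) : qPow τ (-r) = (qPow τ r)⁻¹ := by
  rw [qPow, qPow, ← Complex.exp_neg]
  push_cast
  ring_nf

theorem qPow_natCast (n : ℕ) : qPow τ n = qPow τ 1 ^ n := by
  rw [qPow, qPow, ← Complex.exp_nat_mul]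
  push_cast
  ring_nf

theorem qPow_half_sq : qPow τ (1 / 2) ^ 2 = qPow τ 1 := by
  rw [pow_two, ← qPow_add, add_halves]

theorem norm_qPow_one_lt_one : ‖qPow τ 1‖ < 1 := by
  have norm_lt := UpperHalfPlane.norm_exp_two_pi_I_lt_one τ
  rwa [qPow, Rat.cast_one, mul_one]

end

/-! ### Evaluations -/

section

variable {q u h : ℂ} {δ : ℕ}

theorem nahmHalf_inv_one_one (hq0 : q ≠ 0) (hq : ‖q‖ < 1) (hu : u ≠ 0) (hδ : δ ≤ 1) :
    nahmHalf u u⁻¹ 1 1 q δ = q ^ (δ ^ 2) *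
      (qPochInf (-u * q / q ^ δ) (q ^ 2) * qPochInf (-q ^ (1 + δ) / u) (q ^ 2) *
        qPochInf (-1 * q / q ^ δ) (q ^ 2)) *
      (qPochInf (-q ^ (1 + δ)) (q ^ 2) / qJ q 2 * thetaSeries (u * q ^ (2 * δ)) (q ^ 2)) := by
  rw [nahmHalf_inv hq0 hq hu one_ne_zero, tsum_baileyWeight_one_mul_bilatSum hq0 hq hδ
    (summable_norm_zpow_mul_zpow_sq hq _), ← qJ, thetaSeries]
  congr 2
  refine tsum_congr fun r => ?_
  rw [pow_mul', pow_two (q ^ δ), ← mul_assoc, mul_zpow (u * q ^ δ), pow_two q, mul_zpow q,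
    zpow_add₀ hq0, zpow_mul, zpow_natCast]
  ring

theorem nahmHalf_inv_self_self_one (hq0 : q ≠ 0) (hq : ‖q‖ < 1) (hδ : δ ≤ 1) :
    nahmHalf q⁻¹ q q 1 q δ = q ^ (δ ^ 2) *
      (qPochInf (-q⁻¹ * q / q ^ δ) (q ^ 2) * qPochInf (-q ^ (1 + δ) / q⁻¹) (q ^ 2) *
        qPochInf (-q * q / q ^ δ) (q ^ 2)) *
      (qPochInf (-q ^ δ) (q ^ 2) / qJ q 2 / 2 * thetaSeries (q ^ (2 * δ)) (q ^ 2)) := by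
  have halve := nahmHalf_inv hq0 hq (inv_ne_zero hq0) hq0 δ
  have power (r : ℤ) : (q⁻¹ * q ^ δ) ^ r = q ^ (δ * r - r) := by
    rw [mul_zpow, inv_zpow', ← zpow_natCast, ← zpow_mul, ← zpow_add₀ hq0, neg_add_eq_sub]
  have symm (r : ℤ) : (q⁻¹ * q ^ δ) ^ r * q ^ (r ^ 2) +
      (q⁻¹ * q ^ δ) ^ (-r - δ) * q ^ ((-r - δ) ^ 2) =
      (1 + q ^ (2 * r + δ)) * q ^ (r ^ 2 + δ * r - r) := by
    rw [power, power, one_add_mul, ← zpow_add₀ hq0, ← zpow_add₀ hq0, ← zpow_add₀ hq0]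
    congr 2 <;> ring
  rw [inv_inv] at halve
  rw [halve, tsum_baileyWeight_self_mul_bilatSum hq0 hq hδ
    (summable_norm_zpow_mul_zpow_sq hq _) symm, ← qJ, ← tsum_zpow_natCast_mul_sq_add hq0]
  congr 2
  refine tsum_congr fun r => ?_
  rw [← zpow_add₀ hq0]
  congr 1
  push_cast
  ring

theorem zpow_triangular_add_reflect (hq0 : q ≠ 0) (hδ : δ ≤ 1) (r : ℤ) :
    q ^ (2 * r ^ 2 + r) + q ^ (2 * (-r - δ) ^ 2 + (-r - δ)) =
      (1 + q ^ (2 * r + δ)) * q ^ (2 * r ^ 2 - r + 2 * δ * r) := by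
  rw [one_add_mul, ← zpow_add₀ hq0]
  interval_cases δ
  · rw [add_comm]
    congr 2 <;> push_cast <;> ring
  · congr 2 <;> push_cast <;> ring

theorem summable_norm_zpow_triangular (hq0 : q ≠ 0) (hq : ‖q‖ < 1) :
    Summable fun r : ℤ => ‖q ^ (2 * r ^ 2 + r)‖ := by
  simpa using summable_norm_zpow_natCast_mul_sq_add hq0 hq two_ne_zero 1

theorem nahmHalf_one_one_inv_one (hq0 : q ≠ 0) (hq : ‖q‖ < 1) (hδ : δ ≤ 1) :
    nahmHalf 1 1 q⁻¹ 1 q δ = q ^ (δ ^ 2) *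
      (qPochInf (-1 * q / q ^ δ) (q ^ 2) * qPochInf (-q ^ (1 + δ) / 1) (q ^ 2) *
        qPochInf (-q⁻¹ * q / q ^ δ) (q ^ 2)) *
      (qPochInf (-q ^ (δ + 2)) (q ^ 2) / qJ q 2 * (2 * thetaSeries q (q ^ 2))) := by
  have halve := nahmHalf_inv hq0 hq one_ne_zero (inv_ne_zero hq0) δ
  have summable := (summable_norm_zpow_triangular hq0 hq).of_norm
  have theta : ∑' r : ℤ, q ^ (2 * r ^ 2 + r) = thetaSeries q (q ^ 2) := by
    simpa using tsum_zpow_natCast_mul_sq_add hq0 2 1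
  have reflect := (Equiv.subLeft (-(δ : ℤ))).tsum_eq fun r => q ^ (2 * r ^ 2 + r)
  have reflected := (Equiv.subLeft (-(δ : ℤ))).summable_iff.mpr summable
  have pair (r : ℤ) : (1 * q ^ δ) ^ r * q ^ (r ^ 2) *
      ((1 + q ^ (2 * r + δ)) * q ^ (r ^ 2 + δ * r - r)) =
      q ^ (2 * r ^ 2 + r) + q ^ (2 * (-δ - r) ^ 2 + (-δ - r)) := by
    rw [show -(δ : ℤ) - r = -r - δ by ring,
      zpow_triangular_add_reflect hq0 hδ, mul_left_comm, one_mul, ← zpow_natCast, ← zpow_mul,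
      ← zpow_add₀ hq0, ← zpow_add₀ hq0]
    congr 2
    ring
  rw [inv_one, neg_one_mul] at halve
  rw [neg_one_mul, halve, tsum_baileyWeight_inv_mul_bilatSum hq0 hq hδ
    (summable_norm_zpow_mul_zpow_sq hq _), ← qJ, ← theta, two_mul]
  congr 2
  rw [tsum_congr pair]
  exact (summable.tsum_add reflected).trans (congrArg _ reflect)

theorem nahmHalf_inv_one_self_sqrt (hq0 : q ≠ 0) (hq : ‖q‖ < 1) (hh : h ^ 2 = q) (hδ : δ ≤ 1) :
    nahmHalf q⁻¹ 1 q h q δ = h ^ δ * qPochInf (-1) q * qPochInf (-q * q / q ^ δ) (q ^ 2) *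
      (qPochInf (-q ^ δ) (q ^ 2) / qJ q 2 / 2 * thetaSeries (q ^ (3 * δ)) (q ^ 3)) := by
  rw [nahmHalf_inv_one_sqrt hq0 hq hq0 hh hδ, tsum_baileyWeight_self_mul_bilatSum hq0 hq hδ
    (summable_norm_zpow_triangular hq0 hq) (zpow_triangular_add_reflect hq0 hδ), ← qJ,
    ← tsum_zpow_natCast_mul_sq_add hq0]
  congr 2
  refine tsum_congr fun r => ?_
  rw [← zpow_add₀ hq0]
  congr 1
  push_cast
  ring

theorem nahmHalf_inv_one_one_sqrt (hq0 : q ≠ 0) (hq : ‖q‖ < 1) (hh : h ^ 2 = q) (hδ : δ ≤ 1) :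
    nahmHalf q⁻¹ 1 1 h q δ = h ^ δ * qPochInf (-1) q * qPochInf (-1 * q / q ^ δ) (q ^ 2) *
      (qPochInf (-q ^ (1 + δ)) (q ^ 2) / qJ q 2 * thetaSeries (q ^ (1 + δ)) (q ^ 3)) := by
  rw [nahmHalf_inv_one_sqrt hq0 hq one_ne_zero hh hδ, tsum_baileyWeight_one_mul_bilatSum hq0 hq hδ
    (summable_norm_zpow_triangular hq0 hq), ← qJ, ← tsum_zpow_natCast_mul_sq_add hq0]
  congr 2
  refine tsum_congr fun r => ?_
  rw [← zpow_add₀ hq0]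
  congr 1
  push_cast
  ring

theorem nahmF_inv_one_one (hq0 : q ≠ 0) (hq : ‖q‖ < 1) (hu : u ≠ 0) :
    nahmF u u⁻¹ 1 1 q =
      qJ q 2 ^ 3 * (qPochInf (-(q * u⁻¹)) (q ^ 2) * qPochInf (-(q * u)) (q ^ 2)) *
          (qPochInf (-(q ^ 2 * u)) (q ^ 4) * qPochInf (-(q ^ 2 * u⁻¹)) (q ^ 4)) /
          (qJ q 1 ^ 2 * qJ q 4) +
        2 * q * (qJ q 4 ^ 3 *
          (qPochInf (-u⁻¹) (q ^ 2) * qPochInf (-(q ^ 2 * u)) (q ^ 2)) *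
          (qPochInf (-u) (q ^ 4) * qPochInf (-(q ^ 4 * u⁻¹)) (q ^ 4)) / qJ q 2 ^ 3) := by
  have neg_one := qPochInf_neg_one hq two_ne_zero
  have neg_q := qPochInf_neg_pow_two_mul hq one_ne_zero
  have neg_q_sq := qPochInf_neg_self hq two_ne_zero
  norm_num only [pow_one, mul_one] at neg_one neg_q neg_q_sq
  have theta {z : ℂ} (hz : z ≠ 0) : thetaSeries z (q ^ 2) =
      qPochInf (-(q ^ 2 * z)) (q ^ 4) * qPochInf (-(q ^ 2 * z⁻¹)) (q ^ 4) * qJ q 4 := by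
    rw [thetaSeries_eq_mul (pow_ne_zero 2 hq0) (norm_pow_lt_one hq two_ne_zero) hz, ← pow_mul,
      neg_mul, mul_comm z, neg_div, div_eq_mul_inv, qJ]
  have next {p : ℂ} (hp : ‖p‖ < 1) (z : ℂ) :
      qPochInf (-z) p = (1 + z) * qPochInf (-(p * z)) p := by
    rw [qPochInf_eq_mul hp, neg_mul, mul_comm z, sub_neg_eq_add]
  have shift : q ^ 2 * (q ^ 2 * u)⁻¹ = u⁻¹ := by field_simp
  have shift' : q ^ 2 * (q ^ 2 * u) = q ^ 4 * u := by ring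
  rw [nahmF_eq_add hq0 hq, nahmHalf_inv_one_one hq0 hq hu zero_le_one,
    nahmHalf_inv_one_one hq0 hq hu le_rfl]
  simp only [pow_zero, pow_one, mul_zero, one_pow, mul_one, div_one, one_mul, neg_mul,
    zero_pow two_ne_zero, neg_div, div_self hq0, mul_div_cancel_left₀ _ hq0, add_zero,
    one_add_one_eq_two, mul_comm u, div_eq_mul_inv q, div_eq_mul_inv (q ^ 2)]
  rw [theta hu, theta (mul_ne_zero (pow_ne_zero 2 hq0) hu), shift, shift',
    next (norm_pow_lt_one hq two_ne_zero) u, next (norm_pow_lt_one hq two_ne_zero) u⁻¹,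
    next (norm_pow_lt_one hq four_ne_zero) u, next (norm_pow_lt_one hq four_ne_zero) u⁻¹,
    neg_one, neg_q, neg_q_sq]
  field_simp [qJ_ne_zero hq]

theorem mul_qPochInf_neg_inv_mul_qPochInf_neg_cube (hq0 : q ≠ 0) (hq : ‖q‖ < 1) :
    q * (qPochInf (-q⁻¹) (q ^ 2) * qPochInf (-q ^ 3) (q ^ 2)) = qPochInf (-q) (q ^ 2) ^ 2 := by
  have h2 := norm_pow_lt_one hq two_ne_zero
  have inverse : qPochInf (-q⁻¹) (q ^ 2) = (1 + q⁻¹) * qPochInf (-q) (q ^ 2) := by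
    rw [qPochInf_eq_mul h2, sub_neg_eq_add, neg_mul, pow_two, inv_mul_cancel_left₀ hq0]
  have cube : qPochInf (-q) (q ^ 2) = (1 + q) * qPochInf (-q ^ 3) (q ^ 2) := by
    rw [qPochInf_eq_mul h2, sub_neg_eq_add, neg_mul, ← pow_succ']
  rw [inverse, pow_two (qPochInf _ _)]
  nth_rw 3 [cube]
  field_simp
  ring

theorem nahmF_inv_self_self_one (hq0 : q ≠ 0) (hq : ‖q‖ < 1) :
    nahmF q⁻¹ q q 1 q = 2 * (qJ q 4 ^ 9 / (qJ q 2 ^ 7 * qJ q 8 ^ 2)) +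
      qJ q 2 ^ 7 * qJ q 8 ^ 2 / (qJ q 1 ^ 4 * qJ q 4 ^ 5) := by
  have neg_one := qPochInf_neg_one hq two_ne_zero
  have neg_q := qPochInf_neg_pow_two_mul hq one_ne_zero
  have neg_q_sq := qPochInf_neg_self hq two_ne_zero
  have theta_one := thetaSeries_one_pow hq0 hq two_ne_zero
  have theta_sq := thetaSeries_pow_self hq0 hq two_ne_zero
  norm_num only [pow_one, mul_one] at neg_one neg_q neg_q_sq theta_one theta_sq
  rw [nahmF_eq_add hq0 hq, nahmHalf_inv_self_self_one hq0 hq zero_le_one,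
    nahmHalf_inv_self_self_one hq0 hq le_rfl]
  simp only [pow_zero, pow_one, mul_zero, one_pow, mul_one, div_one, one_mul, neg_mul,
    zero_pow two_ne_zero, inv_mul_cancel₀ hq0, neg_div, div_inv_eq_mul, mul_self_div_self,
    ← pow_succ, Nat.reduceAdd, one_div]
  rw [← mul_assoc q, mul_qPochInf_neg_inv_mul_qPochInf_neg_cube hq0 hq, ← pow_two, neg_one,
    neg_q_sq, neg_q, theta_one, theta_sq]
  field_simp [qJ_ne_zero hq]

theorem nahmF_self_inv_one_sqrt (hq0 : q ≠ 0) (hq : ‖q‖ < 1) (hh : h ^ 2 = q) :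
    nahmF q q⁻¹ 1 h q = 2 * (qJ q 4 * qJ₂ q 5 12 / qJ q 1 ^ 2) +
      2 * h * (qJ q 2 ^ 3 * qJ₂ q 2 12 / (qJ q 1 ^ 3 * qJ q 4)) -
      2 * q * (qJ q 4 * qJ₂ q 1 12 / qJ q 1 ^ 2) := by
  have neg_one := qPochInf_neg_one hq one_ne_zero
  have neg_one' := qPochInf_neg_one hq two_ne_zero
  have neg_q := qPochInf_neg_pow_two_mul hq one_ne_zero
  have neg_q_sq := qPochInf_neg_self hq two_ne_zero
  have theta_one := thetaSeries_one_pow hq0 hq three_ne_zero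
  have theta_cube := thetaSeries_pow_self hq0 hq three_ne_zero
  norm_num only [pow_one, mul_one] at neg_one neg_one' neg_q neg_q_sq theta_one theta_cube
  have split : 2 * (qJ q 4 * qJ₂ q 5 12 / qJ q 1 ^ 2) - 2 * q * (qJ q 4 * qJ₂ q 1 12 / qJ q 1 ^ 2) =
      2 * qJ q 4 / qJ q 1 ^ 2 * (qJ₂ q 5 12 - q * qJ₂ q 1 12) := by ring
  rw [nahmF_rotate hq0 hq, nahmF_eq_add hq0 hq, nahmHalf_inv_one_self_sqrt hq0 hq hh zero_le_one,
    nahmHalf_inv_one_self_sqrt hq0 hq hh le_rfl, add_sub_right_comm, split,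
    qJ₂_five_twelve_sub hq0 hq, qJ₂_two_twelve hq]
  simp only [pow_zero, pow_one, mul_zero, mul_one, div_one, one_mul, neg_mul, neg_div,
    mul_self_div_self]
  rw [← pow_two, neg_one, neg_one', neg_q, neg_q_sq, theta_one, theta_cube]
  field_simp [qJ_ne_zero hq]

theorem nahmF_one_one_inv_sqrt (hq0 : q ≠ 0) (hq : ‖q‖ < 1) (hh : h ^ 2 = q) :
    nahmF 1 1 q⁻¹ h q = 2 * (qJ q 2 ^ 3 * qJ q 6 ^ 2 / (qJ q 1 ^ 3 * qJ q 4 * qJ q 12)) +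
      4 * h * (qJ q 3 * qJ q 4 * qJ q 12 / (qJ q 1 ^ 2 * qJ q 6)) := by
  have neg_one := qPochInf_neg_one hq one_ne_zero
  have neg_one' := qPochInf_neg_one hq two_ne_zero
  have neg_q := qPochInf_neg_pow_two_mul hq one_ne_zero
  have neg_q_sq := qPochInf_neg_self hq two_ne_zero
  norm_num only [pow_one, mul_one] at neg_one neg_one' neg_q neg_q_sq
  rw [nahmF_rotate hq0 hq, nahmF_rotate hq0 hq, nahmF_eq_add hq0 hq,
    nahmHalf_inv_one_one_sqrt hq0 hq hh zero_le_one, nahmHalf_inv_one_one_sqrt hq0 hq hh le_rfl]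
  simp only [pow_zero, pow_one, div_one, one_mul, neg_mul, neg_div, add_zero,
    one_add_one_eq_two, div_self hq0]
  rw [neg_one, neg_one', neg_q, neg_q_sq, thetaSeries_self_cube hq0 hq, thetaSeries_sq_cube hq0 hq]
  field_simp [qJ_ne_zero hq]
  ring

theorem nahmF_one_one_inv_one (hq0 : q ≠ 0) (hq : ‖q‖ < 1) :
    nahmF 1 1 q⁻¹ 1 q = 8 * (qJ q 2 ^ 3 / qJ q 1 ^ 3) := by
  have neg_one := qPochInf_neg_one hq two_ne_zero
  have neg_q := qPochInf_neg_pow_two_mul hq one_ne_zero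
  have neg_q_sq := qPochInf_neg_self hq two_ne_zero
  have theta_q := thetaSeries_pow_two_mul hq0 hq one_ne_zero
  norm_num only [pow_one, mul_one] at neg_one neg_q neg_q_sq theta_q
  have neg_q_mul : q * (qPochInf (-1) (q ^ 2) * qPochInf (-q ^ 2) (q ^ 2) *
        qPochInf (-q⁻¹) (q ^ 2)) *
      (qPochInf (-q ^ 3) (q ^ 2) / qJ q 2 * (2 * thetaSeries q (q ^ 2))) =
      qPochInf (-q) (q ^ 2) ^ 2 * qPochInf (-1) (q ^ 2) *
      (qPochInf (-q ^ 2) (q ^ 2) / qJ q 2 * (2 * thetaSeries q (q ^ 2))) := by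
    rw [← mul_qPochInf_neg_inv_mul_qPochInf_neg_cube hq0 hq]
    ring
  rw [nahmF_eq_add hq0 hq, nahmHalf_one_one_inv_one hq0 hq zero_le_one,
    nahmHalf_one_one_inv_one hq0 hq le_rfl]
  simp only [pow_zero, pow_one, div_one, one_mul, neg_mul, neg_div, add_zero, zero_add,
    one_add_one_eq_two, zero_pow two_ne_zero, one_pow, inv_mul_cancel₀ hq0, div_self hq0, one_div,
    Nat.reduceAdd]
  rw [neg_q_mul, neg_one, neg_q, neg_q_sq, theta_q]
  field_simp [qJ_ne_zero hq]
  ring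

theorem mainTheorem2_general (hq0 : q ≠ 0) (hq : ‖q‖ < 1) (hh : h ^ 2 = q) :
    (∀ u v w t : ℂ, Summable (nahmTerm u v w t q)) ∧
    (∀ u : ℂ, u ≠ 0 → nahmF u u⁻¹ 1 1 q =
      qJ q 2 ^ 3 * (qPochInf (-(q * u⁻¹)) (q ^ 2) * qPochInf (-(q * u)) (q ^ 2)) *
          (qPochInf (-(q ^ 2 * u)) (q ^ 4) * qPochInf (-(q ^ 2 * u⁻¹)) (q ^ 4)) /
          (qJ q 1 ^ 2 * qJ q 4) +
        2 * q * (qJ q 4 ^ 3 *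
          (qPochInf (-u⁻¹) (q ^ 2) * qPochInf (-(q ^ 2 * u)) (q ^ 2)) *
          (qPochInf (-u) (q ^ 4) * qPochInf (-(q ^ 4 * u⁻¹)) (q ^ 4)) / qJ q 2 ^ 3)) ∧
    nahmF q⁻¹ q q 1 q = 2 * (qJ q 4 ^ 9 / (qJ q 2 ^ 7 * qJ q 8 ^ 2)) +
      qJ q 2 ^ 7 * qJ q 8 ^ 2 / (qJ q 1 ^ 4 * qJ q 4 ^ 5) ∧
    nahmF q q⁻¹ 1 h q = 2 * (qJ q 4 * qJ₂ q 5 12 / qJ q 1 ^ 2) +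
      2 * h * (qJ q 2 ^ 3 * qJ₂ q 2 12 / (qJ q 1 ^ 3 * qJ q 4)) -
      2 * q * (qJ q 4 * qJ₂ q 1 12 / qJ q 1 ^ 2) ∧
    nahmF 1 1 q⁻¹ h q = 2 * (qJ q 2 ^ 3 * qJ q 6 ^ 2 / (qJ q 1 ^ 3 * qJ q 4 * qJ q 12)) +
      4 * h * (qJ q 3 * qJ q 4 * qJ q 12 / (qJ q 1 ^ 2 * qJ q 6)) ∧
    nahmF 1 1 q⁻¹ 1 q = 8 * (qJ q 2 ^ 3 / qJ q 1 ^ 3) :=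
  ⟨summable_nahmTerm hq0 hq, fun _ => nahmF_inv_one_one hq0 hq,
    nahmF_inv_self_self_one hq0 hq, nahmF_self_inv_one_sqrt hq0 hq hh,
    nahmF_one_one_inv_sqrt hq0 hq hh, nahmF_one_one_inv_one hq0 hq⟩

end

end

theorem mainTheorem2 (τ : ℍ) (q : ℂ) (hq : q = qPow τ 1) :
    (∀ u v w t : ℂ, Summable (nahmTerm u v w t q)) ∧
    (∀ b : ℚ,
      nahmF (qPow τ b) (qPow τ (-b)) 1 1 q =
        qJ q 2 ^ 3 *
            (qPochInf (-qPow τ (1 - b)) (q ^ 2) * qPochInf (-qPow τ (1 + b)) (q ^ 2)) *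
            (qPochInf (-qPow τ (2 + b)) (q ^ 4) * qPochInf (-qPow τ (2 - b)) (q ^ 4)) /
            (qJ q 1 ^ 2 * qJ q 4)
          + 2 * q *
            (qJ q 4 ^ 3 *
              (qPochInf (-qPow τ (-b)) (q ^ 2) * qPochInf (-qPow τ (2 + b)) (q ^ 2)) *
              (qPochInf (-qPow τ b) (q ^ 4) * qPochInf (-qPow τ (4 - b)) (q ^ 4)) /
              qJ q 2 ^ 3)) ∧
    nahmF q⁻¹ q q 1 q =
      2 * (qJ q 4 ^ 9 / (qJ q 2 ^ 7 * qJ q 8 ^ 2))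
        + qJ q 2 ^ 7 * qJ q 8 ^ 2 / (qJ q 1 ^ 4 * qJ q 4 ^ 5) ∧
    nahmF q q⁻¹ 1 (qPow τ (1 / 2)) q =
      2 * (qJ q 4 * qJ₂ q 5 12 / qJ q 1 ^ 2)
        + 2 * qPow τ (1 / 2) * (qJ q 2 ^ 3 * qJ₂ q 2 12 / (qJ q 1 ^ 3 * qJ q 4))
        - 2 * q * (qJ q 4 * qJ₂ q 1 12 / qJ q 1 ^ 2) ∧
    nahmF 1 1 q⁻¹ (qPow τ (1 / 2)) q =
      2 * (qJ q 2 ^ 3 * qJ q 6 ^ 2 / (qJ q 1 ^ 3 * qJ q 4 * qJ q 12))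
        + 4 * qPow τ (1 / 2) * (qJ q 3 * qJ q 4 * qJ q 12 / (qJ q 1 ^ 2 * qJ q 6)) ∧
    nahmF 1 1 q⁻¹ 1 q = 8 * (qJ q 2 ^ 3 / qJ q 1 ^ 3)  := by
  subst hq
  have hsq : qPow τ 2 = qPow τ 1 ^ 2 := mod_cast qPow_natCast τ 2
  have hfourth : qPow τ 4 = qPow τ 1 ^ 4 := mod_cast qPow_natCast τ 4
  obtain ⟨hsummable, hpart₁, hrest⟩ := mainTheorem2_general (qPow_ne_zero τ 1)
    (norm_qPow_one_lt_one τ) (qPow_half_sq τ)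
  refine ⟨hsummable, fun b => ?_, hrest⟩
  simpa only [sub_eq_add_neg, qPow_add, qPow_neg, hsq, hfourth] using
    hpart₁ (qPow τ b) (qPow_ne_zero τ b)
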